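/- **Conventions.** All groups are torsion-free Abelian groups; $\tilde H$ is the divisible hull of $H$. The $p$-height of $x$ in $H$ is the supremum in $\{0,1,\dots,\infty\}$ of all $k$ with $x\in p^kH$; the characteristic of $x$ is the family of its $p$-heights over all primes $p$. A type is a class of characteristics $\mathbb P\to\{0,1,\dots,\infty\}$ modulo changing finitely many finite values to finite values, and types are ordered by $\tau\le\sigma$ if $\chi\le\chi'$ pointwise for some $\chi\in\tau$, $\chi'\in\sigma$. The type of a group of rank $1$ is the type of any of its nonzero elements. A type $\tau$ is idempotent if it contains a characteristic with values in $\{0,\infty\}$. Put $P_0(\tau)=\{p\mid\tau(p)\ne\infty\}$; a $P_0(\tau)$-integer is an integer all of whose prime divisors lie in $P_0(\tau)$. For idempotent $\tau$ let $R_\tau$ be the unital subring of $\mathbb Q$ whose additive group has type $\tau$. A group is completely decomposable if it is a finite direct sum of groups of rank $1$, and almost completely decomposable if it has a completely decomposable subgroup of finite index. For such a group $G$, the regulator $\mathrm{Reg}\,G$ is the intersection of all completely decomposable subgroups of lowest finite index; $\mathrm{Reg}_\tau G$ denotes the sum of the summands of type $\tau$ in a decomposition of $\mathrm{Reg}\,G$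 into groups of rank $1$, and $T(G)=\{\tau\mid \mathrm{Reg}_\tau G\ne 0\}$. The group $G$ is a CRQ-group if $G/\mathrm{Reg}\,G$ is cyclic, block-rigid if the types in $T(G)$ are pairwise incomparable, rigid if moreover each $\mathrm{Reg}_\tau G$ $(\tau\in T(G))$ has rank $1$, and of ring type if all types in $T(G)$ are idempotent. Let $G$ be a block-rigid CRQ-group of ring type, $A=\mathrm{Reg}\,G=\bigoplus_{\tau\in T(G)}A_\tau$ with $A_\tau=\mathrm{Reg}_\tau G$, and let $\pi_\tau:\tilde G=\bigoplus_{\sigma\in T(G)}\tilde A_\sigma\to\tilde A_\tau$ be the projections. Let $m_\tau=m_\tau(G)$ be the order of $\pi_\tau(d)+A$ in $\tilde A/A$ for any $d\in G$ with $G/A=\langle d+A\rangle$ (it does not depend on $d$). Fix a main decomposition $G=G_1\oplus C$, that is, $C$ is completely decomposable, $G_1$ is a rigid CRQ-group, $T(G_1)=\{\tau\in T(G)\mid m_\tau>1\}$, and $m_\tau(G_1)=m_\tau(G)$ for $\tau\in T(G_1)$. Put $B=\mathrm{Reg}\,G_1$, so $T(B)=T(G_1)$ and $B=\bigoplus_{\tau\in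 T(B)}B_\tau$ with $B_\tau=\mathrm{Reg}_\tau G_1$. Put $D=\{d\in G_1\mid G/A=\langle d+A\rangle\}$. For a system $E_0=\{e_0^{(\tau)}\in B_\tau\mid\tau\in T(B)\}$ with $B=\bigoplus_{\tau\in T(B)}R_\tau e_0^{(\tau)}$, where the characteristic of each $e_0^{(\tau)}$ lies in $\tau$ and has values in $\{0,\infty\}$, let $D(E_0)$ be the set of all $d\in D$ such that $$d=\sum_{\tau\in T(B)}\frac{s_\tau}{m_\tau}e_0^{(\tau)},\qquad s_\tau\in\mathbb Z,\quad\gcd(s_\tau,m_\tau)=1,\quad s_\tau\text{ and }m_\tau\text{ are }P_0(\tau)\text{-integers};$$ the $s_\tau$ are determined by $(d,E_0)$. The system $E_0$ is a $B$-basis if $D(E_0)\neq\emptyset$. Let $I_\tau$ consist of $0$ if $\tau\in T(B)$, and of $1,\dots,k_\tau$, where $k_\tau$ is the rank of $C_\tau=\mathrm{Reg}_\tau C$. An $A$-basis is a system $E=\{e_i^{(\tau)}\in A_\tau\mid\tau\in T(G),\,i\in I_\tau\}$ with $A=\bigoplus_{\tau\in T(G)}\bigoplus_{i\in I_\tau}R_\tau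 e_i^{(\tau)}$ (all $e_i^{(\tau)}\neq0$) whose part $E_0=\{e_0^{(\tau)}\mid\tau\in T(B)\}$ is a $B$-basis. A system $U=\{u_{ij}^{(\tau)}\in A_\tau\mid\tau\in T(G),\,i,j\in I_\tau\}$ defines a multiplication on $G$ with respect to $E$ if there is a homomorphism $\mu:G\otimes G\to G$ with $\mu(e_i^{(\tau)}\otimes e_j^{(\tau)})=u_{ij}^{(\tau)}$ for all $\tau\in T(G)$, $i,j\in I_\tau$. Write $\overline U=(U^{(\tau)})_{\tau\in T(G)}$ with $U^{(\tau)}=(u_{ij}^{(\tau)})_{i,j\in I_\tau}$, rows and columns being taken in increasing order of the indices. Let $M^{(2)}$ be the group of all tuples $(Y^{(\tau)})_{\tau\in T(G)}$ of such matrices over $A_\tau$ in which the entry in the first row and first column of $Y^{(\tau)}$ lies in $m_\tau^2A_\tau$ and the other entries of the first row and of the first column lie in $m_\tau A_\tau$. For $d\in D(E_0)$ let $X=X(d,E_0)$ be the tuple whose $\tau$-th matrix, for $\tau\in T(B)$, has entry $m_\tau s_\tau^{-1}e_0^{(\tau)}$ in the first row and first column and zeros elsewhere, where $s_\tau^{-1}$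 is an integer inverse to $s_\tau$ modulo $m_\tau$, and whose $\tau$-th matrix is zero for $\tau\in T(G)\setminus T(B)$. Put $M(d,E_0)=\langle X,M^{(2)}\rangle$ (it does not depend on the choice of the $s_\tau^{-1}$). **Theorem 2.4.** Let $G$ be a block-rigid CRQ-group of ring type with a fixed main decomposition $G=G_1\oplus C$, let $E$ be an $A$-basis of $G$ containing the $B$-basis $E_0$, and let $U=\{u_{ij}^{(\tau)}\in A_\tau\mid\tau\in T(G),\,i,j\in I_\tau\}$. The following conditions are equivalent. 1. $U$ defines a multiplication on $G$ with respect to the $A$-basis $E$. 2. $\overline U\in M(d,E_0)$ for every $d\in D(E_0)$. 3. $\overline U\in M(d,E_0)$ for some $d\in D(E_0)$. -/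

import Mathlib

open scoped TensorProduct

/-!
A torsion-free Abelian group is regarded as an additive subgroup `G` of a rational vector space `V`
(every torsion-free group is of this form, e.g. inside `ℚ ⊗ G`).  The divisible hull of a subgroup
`H` of `V` is then the rational subspace `Submodule.span ℚ H` spanned by `H`.
-/

namespace CRQ

/-! ### Characteristics and types -/

/-- A characteristic: a family of non-negative integers and symbols `∞`, indexed by the primes. -/
abbrev Characteristic : Type := Nat.Primes → ℕ∞

/-- Two characteristics are equivalent if they differ at finitely many primes only, and only at
primes where both of them are finite. -/
instance characteristicSetoid : Setoid Characteristic where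
  r χ χ' := {p | χ p ≠ χ' p}.Finite ∧ ∀ p, χ p = ⊤ ↔ χ' p = ⊤
  iseqv :=
    { refl := fun χ => by simp
      symm := fun {χ χ'} h => by
        refine ⟨h.1.subset ?_, fun p => (h.2 p).symm⟩
        intro p hp
        exact fun hh => hp hh.symm
      trans := fun {χ χ' χ''} h h' => by
        refine ⟨(h.1.union h'.1).subset ?_, fun p => (h.2 p).trans (h'.2 p)⟩
        intro p hp
        by_contra hc
        simp only [Set.mem_union, Set.mem_ofPred_eq, not_or, not_not] at hc
        exact hp (hc.1.trans hc.2) }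

/-- A type: an equivalence class of characteristics. -/
def GroupType : Type := Quotient characteristicSetoid

/-- The type of a characteristic. -/
def GroupType.mk (χ : Characteristic) : GroupType := Quotient.mk characteristicSetoid χ

/-- The order on types: `τ ≤ σ` if some characteristic in `τ` is pointwise at most some
characteristic in `σ`. -/
instance : LE GroupType where
  le τ σ := ∃ χ χ' : Characteristic, GroupType.mk χ = τ ∧ GroupType.mk χ' = σ ∧ χ ≤ χ'

/-- A type is idempotent if it contains a characteristic consisting of zeros and symbols `∞`. -/
def GroupType.IsIdempotent (τ : GroupType) : Prop :=
  ∃ χ : Characteristic, GroupType.mk χ = τ ∧ ∀ p, χ p = 0 ∨ χ p = ⊤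

/-- `P_∞(τ)`: the set of primes `p` with `τ(p) = ∞`. -/
def GroupType.PInf (τ : GroupType) : Set Nat.Primes :=
  {p | ∃ χ : Characteristic, GroupType.mk χ = τ ∧ χ p = ⊤}

/-- `P_0(τ)`: the set of the remaining primes. -/
def GroupType.PZero (τ : GroupType) : Set Nat.Primes := (τ.PInf)ᶜ

/-- For a set `P` of primes, a `P`-integer is an integer all of whose prime divisors are in `P`. -/
def IsPrimesInteger (P : Set Nat.Primes) (k : ℤ) : Prop :=
  ∀ p : Nat.Primes, ((p : ℕ) : ℤ) ∣ k → p ∈ P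

/-- The unital subring `R_τ` of `ℚ`: all fractions whose denominators have prime divisors in
`P_∞(τ)` only.  For an idempotent type `τ` this is the unital subring of `ℚ` whose additive group
has type `τ`. -/
def ratRing (τ : GroupType) : Subring ℚ where
  carrier := {q | ∀ p : Nat.Primes, (p : ℕ) ∣ q.den → p ∈ τ.PInf}
  mul_mem' := fun {a b} ha hb p hp =>
    ((p.2.dvd_mul).1 (hp.trans (Rat.mul_den_dvd a b))).elim (ha p) (hb p)
  one_mem' := fun p hp => absurd hp (by simpa using p.2.one_lt.ne')
  add_mem' := fun {a b} ha hb p hp =>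
    ((p.2.dvd_mul).1 (hp.trans (Rat.add_den_dvd a b))).elim (ha p) (hb p)
  zero_mem' := fun p hp => absurd hp (by simpa using p.2.one_lt.ne')
  neg_mem' := fun {a} ha p hp => ha p (by simpa using hp)

variable {V : Type*} [AddCommGroup V] [Module ℚ V]

/-- The `p`-height of `x` in the group `H`: the supremum in `{0, 1, …, ∞}` of all `k` for which `x`
is divisible by `p ^ k` in `H`. -/
noncomputable def height (H : AddSubgroup V) (p : Nat.Primes) (x : V) : ℕ∞ :=
  ⨆ (k : ℕ) (_ : ∃ y ∈ H, (p : ℕ) ^ k • y = x), (k : ℕ∞)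

/-- The characteristic of `x` in the group `H`. -/
noncomputable def characteristic (H : AddSubgroup V) (x : V) : Characteristic :=
  fun p => height H p x

/-- The rank one group `L` has type `τ`: every nonzero element of `L` has a characteristic in
`τ`. -/
def HasType (L : AddSubgroup V) (τ : GroupType) : Prop :=
  ∀ x ∈ L, x ≠ 0 → GroupType.mk (characteristic L x) = τ

/-! ### Completely decomposable and almost completely decomposable groups -/

/-- `A` is the direct sum of the groups `L i`, each of which has rank one. -/
def IsRankOneDecomposition (A : AddSubgroup V) {n : ℕ} (L : Fin n → AddSubgroup V) : Prop :=
  (∀ i, Module.finrank ℤ (L i) = 1) ∧ iSupIndep L ∧ ⨆ i, L i = A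

/-- `A` is a completely decomposable group of finite rank. -/
def IsCompletelyDecomposable (A : AddSubgroup V) : Prop :=
  ∃ (n : ℕ) (L : Fin n → AddSubgroup V), IsRankOneDecomposition A L

/-- `W` is a completely decomposable subgroup of finite index of `G`. -/
def IsCDSubgroup (G W : AddSubgroup V) : Prop :=
  W ≤ G ∧ IsCompletelyDecomposable W ∧ W.relIndex G ≠ 0

/-- `G` is almost completely decomposable: it has a completely decomposable subgroup (of finite
rank) of finite index.  Then `G` itself has finite rank. -/
def IsACD (G : AddSubgroup V) : Prop := ∃ W, IsCDSubgroup G W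

/-- The regulator `Reg G`: the intersection of all completely decomposable subgroups of lowest
index. -/
def reg (G : AddSubgroup V) : AddSubgroup V :=
  sInf {W | IsCDSubgroup G W ∧ ∀ W', IsCDSubgroup G W' → W.relIndex G ≤ W'.relIndex G}

/-- The component `A_τ` of a completely decomposable group `A`: the sum of the summands of type `τ`
in a decomposition of `A` into groups of rank one.  For block-rigid groups this does not
depend on the decomposition; here it is the sum over all decompositions. -/
def component (A : AddSubgroup V) (τ : GroupType) : AddSubgroup V :=
  ⨆ (n : ℕ) (L : Fin n → AddSubgroup V) (_ : IsRankOneDecomposition A L)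
    (i : Fin n) (_ : HasType (L i) τ), L i

/-- `Reg_τ G`. -/
def regComponent (G : AddSubgroup V) (τ : GroupType) : AddSubgroup V := component (reg G) τ

/-- The set `T(G)` of critical types. -/
def critTypes (G : AddSubgroup V) : Set GroupType := {τ | regComponent G τ ≠ ⊥}

/-- `G` is a CRQ-group: it is almost completely decomposable and the regulator quotient
`G / Reg G` is cyclic. -/
def IsCRQ (G : AddSubgroup V) : Prop := IsACD G ∧ IsAddCyclic (G ⧸ (reg G).addSubgroupOf G)

/-- The critical types are pairwise incomparable. -/
def IsBlockRigid (G : AddSubgroup V) : Prop := IsAntichain (· ≤ ·) (critTypes G)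

/-- `G` is block-rigid and all the groups `Reg_τ G` with `τ ∈ T(G)` have rank one. -/
def IsRigid (G : AddSubgroup V) : Prop :=
  IsBlockRigid G ∧ ∀ τ ∈ critTypes G, Module.finrank ℤ (regComponent G τ) = 1

/-- All critical types are idempotent. -/
def IsOfRingType (G : AddSubgroup V) : Prop := ∀ τ ∈ critTypes G, τ.IsIdempotent

/-! ### The invariants `m_τ` and main decompositions -/

/-- `G / Reg G = ⟨d + Reg G⟩`. -/
def GeneratesRegQuotient (G : AddSubgroup V) (d : V) : Prop :=
  AddSubgroup.zmultiples d ⊔ reg G = G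

/-- The divisible hull of `Reg_τ G`. -/
def hullComponent (G : AddSubgroup V) (τ : GroupType) : Submodule ℚ V :=
  Submodule.span ℚ (regComponent G τ : Set V)

open scoped Classical in
/-- The projection `π_τ` of the divisible hull `⨁ σ ∈ T(G), hull (Reg_σ G)` of `G` onto its summand
with index `τ`. -/
noncomputable def proj (G : AddSubgroup V) (τ : GroupType) (x : V) : V :=
  if h : ∃ y ∈ hullComponent G τ, x - y ∈ ⨆ (σ : GroupType) (_ : σ ≠ τ), hullComponent G σ
  then h.choose else 0

/-- The invariant `m_τ(G)`: the order of `π_τ(d) + Reg G`, where `d` is any element with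
`G / Reg G = ⟨d + Reg G⟩`.  The order does not depend on `d`, so that the set below has only one
element. -/
noncomputable def mInv (G : AddSubgroup V) (τ : GroupType) : ℕ :=
  sInf {m | ∃ d : V, GeneratesRegQuotient G d ∧
    m = addOrderOf (QuotientAddGroup.mk (proj G τ d) : V ⧸ reg G)}

/-- `G = G₁ ⊕ C` is a main decomposition of `G`. -/
structure IsMainDecomposition (G G₁ C : AddSubgroup V) : Prop where
  disjoint : Disjoint G₁ C
  sup_eq : G₁ ⊔ C = G
  completelyDecomposable : IsCompletelyDecomposable C
  isCRQ : IsCRQ G₁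
  isRigid : IsRigid G₁
  mem_critTypes_iff : ∀ τ, τ ∈ critTypes G₁ ↔ τ ∈ critTypes G ∧ 1 < mInv G τ
  mInv_eq : ∀ τ ∈ critTypes G₁, mInv G₁ τ = mInv G τ

/-! ### Bases.  Here `G = G₁ ⊕ C` is a main decomposition, `A = Reg G` and `B = Reg G₁`. -/

/-- `D`: the set of all `d ∈ G₁` with `G / A = ⟨d + A⟩`. -/
def genSet (G G₁ : AddSubgroup V) : Set V := {d | d ∈ G₁ ∧ GeneratesRegQuotient G d}

/-- `d = ∑ τ ∈ T(B), (s_τ / m_τ) e₀^(τ)` is a standard representation: `d ∈ D`, each `s_τ` is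
co-prime to `m_τ`, and `s_τ`, `m_τ` are `P_0(τ)`-integers. -/
structure IsStandardRep (G G₁ : AddSubgroup V) (e₀ : GroupType → V) (d : V) (s : GroupType → ℤ) :
    Prop where
  mem : d ∈ genSet G G₁
  eq_sum : d = ∑ᶠ τ ∈ critTypes G₁, ((s τ : ℚ) / (mInv G τ : ℚ)) • e₀ τ
  coprime : ∀ τ ∈ critTypes G₁, IsCoprime (s τ) (mInv G τ : ℤ)
  num_isPrimesInteger : ∀ τ ∈ critTypes G₁, IsPrimesInteger τ.PZero (s τ)
  den_isPrimesInteger : ∀ τ ∈ critTypes G₁, IsPrimesInteger τ.PZero (mInv G τ : ℤ)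

/-- `D(E₀)`: the set of all elements `d` which define the `B`-basis `E₀`. -/
def genSetOf (G G₁ : AddSubgroup V) (e₀ : GroupType → V) : Set V :=
  {d | ∃ s : GroupType → ℤ, IsStandardRep G G₁ e₀ d s}

/-- The system `E₀ = {e₀^(τ) ∈ B_τ | τ ∈ T(B)}` is a `B`-basis of `G`: the group `B` is the direct
sum of the free cyclic modules `R_τ e₀^(τ)`, the characteristics of the `e₀^(τ)` belong to `τ` and
consist of zeros and symbols `∞`, and some `d` has a standard representation in `E₀`. -/
structure IsBBasis (G G₁ : AddSubgroup V) (e₀ : GroupType → V) : Prop where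
  mem : ∀ τ ∈ critTypes G₁, e₀ τ ∈ regComponent G₁ τ
  linearIndependent : LinearIndependent ℚ (fun τ : critTypes G₁ => e₀ τ)
  closure_eq : AddSubgroup.closure {x | ∃ τ ∈ critTypes G₁, ∃ r ∈ ratRing τ, x = r • e₀ τ} = reg G₁
  type_eq : ∀ τ ∈ critTypes G₁, GroupType.mk (characteristic G (e₀ τ)) = τ
  height_eq : ∀ τ ∈ critTypes G₁, ∀ p, height G p (e₀ τ) = 0 ∨ height G p (e₀ τ) = ⊤
  nonempty : (genSetOf G G₁ e₀).Nonempty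

open scoped Classical in
/-- The index set `I_τ`: it contains `0` if `τ ∈ T(B)`, and the numbers `1, …, k_τ`, where `k_τ` is
the rank of `C_τ` (which is zero if `τ ∉ T(C)`). -/
noncomputable def idx (G₁ C : AddSubgroup V) (τ : GroupType) : Finset ℕ :=
  (if τ ∈ critTypes G₁ then {0} else ∅) ∪ Finset.Icc 1 (Module.finrank ℤ (component C τ))

/-- The system `E = {e_i^(τ) ∈ A_τ | τ ∈ T(G), i ∈ I_τ}` is an `A`-basis of `G`: the group `A` is
the direct sum of the free cyclic modules `R_τ e_i^(τ)`, and the elements with index `0` form a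
`B`-basis. -/
structure IsABasis (G G₁ C : AddSubgroup V) (e : GroupType → ℕ → V) : Prop where
  mem : ∀ τ ∈ critTypes G, ∀ i ∈ idx G₁ C τ, e τ i ∈ regComponent G τ
  linearIndependent :
    LinearIndependent ℚ (fun x : Σ τ : critTypes G, idx G₁ C (τ : GroupType) => e x.1 x.2)
  closure_eq : AddSubgroup.closure
    {x | ∃ τ ∈ critTypes G, ∃ i ∈ idx G₁ C τ, ∃ r ∈ ratRing τ, x = r • e τ i} = reg G
  isBBasis : IsBBasis G G₁ (fun τ => e τ 0)

/-! ### Multiplications and matrices -/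

/-- The system `U = {u_ij^(τ)}` defines a multiplication on `G` with respect to `E`: there is a
homomorphism `μ : G ⊗ G → G` with `μ (e_i^(τ) ⊗ e_j^(τ)) = u_ij^(τ)`. -/
def DefinesMultiplication (G G₁ C : AddSubgroup V) (e : GroupType → ℕ → V)
    (U : GroupType → ℕ → ℕ → V) : Prop :=
  ∃ μ : (G ⊗[ℤ] G) →+ G, ∀ τ ∈ critTypes G, ∀ i ∈ idx G₁ C τ, ∀ j ∈ idx G₁ C τ,
    ∀ x y : G, (x : V) = e τ i → (y : V) = e τ j → ((μ (x ⊗ₜ[ℤ] y) : G) : V) = U τ i j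

/-- Families, indexed by `τ ∈ T(G)`, of square matrices with rows and columns indexed by `I_τ` in
increasing order. -/
abbrev MatrixTuple (G G₁ C : AddSubgroup V) : Type _ :=
  ∀ τ : critTypes G, Matrix (idx G₁ C τ) (idx G₁ C τ) V

/-- The matrix tuple of the system `U`. -/
def matrixTuple (G G₁ C : AddSubgroup V) (U : GroupType → ℕ → ℕ → V) : MatrixTuple G G₁ C :=
  fun τ i j => U τ i j

/-- The subgroup `k A = {k a | a ∈ A}`. -/
def mulSubgroup (k : ℕ) (A : AddSubgroup V) : AddSubgroup V := A.map (nsmulAddMonoidHom k)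

/-- The group `M^(2)` of all tuples of matrices over the groups `A_τ` with `(1, 1)`-entry in
`m_τ² A_τ` and with the other entries of the first row and of the first column in `m_τ A_τ`. -/
def M2 (G G₁ C : AddSubgroup V) : AddSubgroup (MatrixTuple G G₁ C) where
  carrier := {Y | ∀ (τ : critTypes G) (i j : idx G₁ C τ),
    Y τ i j ∈ regComponent G τ ∧
    (IsBot i ∨ IsBot j →
      Y τ i j ∈ mulSubgroup (mInv G τ) (regComponent G τ)) ∧
    (IsBot i ∧ IsBot j →
      Y τ i j ∈ mulSubgroup (mInv G τ ^ 2) (regComponent G τ))}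
  add_mem' := fun hX hY τ i j =>
    ⟨add_mem (hX τ i j).1 (hY τ i j).1,
      fun h => add_mem ((hX τ i j).2.1 h) ((hY τ i j).2.1 h),
      fun h => add_mem ((hX τ i j).2.2 h) ((hY τ i j).2.2 h)⟩
  zero_mem' := fun _ _ _ => ⟨zero_mem _, fun _ => zero_mem _, fun _ => zero_mem _⟩
  neg_mem' := fun hX τ i j =>
    ⟨neg_mem (hX τ i j).1, fun h => neg_mem ((hX τ i j).2.1 h), fun h => neg_mem ((hX τ i j).2.2 h)⟩

open scoped Classical in
/-- The integers `s_τ` (`τ ∈ T(B)`) of the standard representation related to `(d, E₀)`; they are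
uniquely determined by `d` and `E₀`. -/
noncomputable def stdCoeff (G G₁ : AddSubgroup V) (e₀ : GroupType → V) (d : V) : GroupType → ℤ :=
  if h : ∃ s : GroupType → ℤ, IsStandardRep G G₁ e₀ d s then h.choose else 0

/-- The tuple `X = X(d, E₀)`: for `τ ∈ T(B)` the entry with index `(0, 0)` is
`m_τ s_τ⁻¹ e₀^(τ)`, where `s_τ⁻¹` is an integer inverse to `s_τ` modulo `m_τ` (a Bézout
coefficient); all other entries are zero.  Note that `0 ∈ I_τ` if and only if `τ ∈ T(B)`. -/
noncomputable def tupleX (G G₁ C : AddSubgroup V) (e₀ : GroupType → V) (d : V) :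
    MatrixTuple G G₁ C :=
  fun τ i j =>
    if (i : ℕ) = 0 ∧ (j : ℕ) = 0 then
      ((mInv G τ : ℤ) * Int.gcdA (stdCoeff G G₁ e₀ d τ) (mInv G τ)) • e₀ τ
    else 0

/-- The group `M(d, E₀) = ⟨X, M^(2)⟩`. -/
noncomputable def groupM (G G₁ C : AddSubgroup V) (e₀ : GroupType → V) (d : V) :
    AddSubgroup (MatrixTuple G G₁ C) :=
  AddSubgroup.zmultiples (tupleX G G₁ C e₀ d) ⊔ M2 G G₁ C

end CRQ

set_option linter.unusedSectionVars false

namespace CRQ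

/-! ### Types and divisibility -/

/-! Fix `d` in `D(E₀)`, so that `G = ℤd + A` and `d` has the coordinate `s_τ/m_τ` at each `e_0^(τ)`
and zero elsewhere. A multiplication on `G` is determined by its values on the `A`-basis. Values on
basis elements of different types must vanish: the product inherits infinite `p`-divisibility from
both factors, and for incomparable idempotent types no nonzero element can be divisible by both sets
of primes (`mul_eq_zero_of_ne`). So `U` determines a bilinear form on the divisible hull, and the
question is when this form maps `G × G` into `G`. Since each `A_τ` is an `R_τ`-module, products of
elements of `A` cause no obstruction; only `dA`, `Ad` and `d·d` matter.

The product of `d` with `e_j^(τ)` is `(s_τ/m_τ) u_0j`, of type `τ`. Because `A_τ` is pure in `G`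
(`IsFrame.mem_reg_of_isSupported`), it lies in `G` only if it lies in `A_τ`; since `s_τ` is
invertible modulo `m_τ`, this means `u_0j ∈ m_τ A_τ`. The same holds for columns.

The product `d·d` lies in `G` iff `d·d - kd ∈ A` for some integer `k`, that is, `(s_τ/m_τ)² u_00 - k
(s_τ/m_τ) e_0 ∈ A_τ` for all `τ ∈ T(B)` with one common `k`. Multiplying by the square of an inverse
of `s_τ` turns this into `u_00 - k m_τ s_τ⁻¹ e_0 ∈ m_τ² A_τ`, given the row condition. Together
these say that `U - kX` lies in `M^(2)` (`mem_groupM_iff`). The choice of `d` was arbitrary, so one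
`d` is as good as all. -/

theorem GroupType.mem_PInf_mk {χ : Characteristic} {p : Nat.Primes} :
    p ∈ (GroupType.mk χ).PInf ↔ χ p = ⊤ := by
  constructor
  · rintro ⟨χ', h, hp⟩
    have h' : χ' ≈ χ := Quotient.exact h
    exact (h'.2 p).1 hp
  · exact fun h => ⟨χ, rfl, h⟩

/-- A representative with values 0 and ∞ only is bounded by any characteristic that is infinite at
the same primes. Incomparability of ring types thus becomes a statement about the sets `P_∞`, which
divisibility arguments can use. -/
theorem GroupType.IsIdempotent.le_of_PInf_subset {τ σ : GroupType} (hτ : τ.IsIdempotent)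
    (h : τ.PInf ⊆ σ.PInf) : τ ≤ σ := by
  obtain ⟨χ, rfl, hχ⟩ := hτ
  obtain ⟨χ', rfl⟩ : ∃ χ', GroupType.mk χ' = σ := Quotient.exists_rep σ
  refine ⟨χ, χ', rfl, rfl, fun p => ?_⟩
  rcases hχ p with h0 | h1
  · simp [h0]
  · rw [GroupType.mem_PInf_mk.1 (h (GroupType.mem_PInf_mk.2 h1))]
    exact le_top

section Divisible

variable {V : Type*} [AddCommGroup V] [Module ℚ V]

/-- `x` is divisible by all powers of `p` in the group `H`. -/
def IsPDivisible (H : AddSubgroup V) (p : Nat.Primes) (x : V) : Prop :=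
  ∀ k : ℕ, ∃ y ∈ H, (p : ℕ) ^ k • y = x

theorem IsPDivisible.mono {H K : AddSubgroup V} (h : H ≤ K) {p : Nat.Primes} {x : V}
    (hx : IsPDivisible H p x) : IsPDivisible K p x := fun k => by
  obtain ⟨y, hy, e⟩ := hx k
  exact ⟨y, h hy, e⟩

theorem isPDivisible_of_height_eq_top {H : AddSubgroup V} {p : Nat.Primes} {x : V}
    (h : height H p x = ⊤) : IsPDivisible H p x := by
  intro k
  have hk : (k : ℕ∞) < height H p x := by
    rw [h]; exact ENat.natCast_lt_top k
  simp only [height, lt_iSup_iff] at hk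
  obtain ⟨l, ⟨y, hy, rfl⟩, hl⟩ := hk
  have hkl : k ≤ l := by exact_mod_cast hl.le
  refine ⟨(p : ℕ) ^ (l - k) • y, nsmul_mem hy _, ?_⟩
  rw [smul_smul, ← pow_add, Nat.add_sub_cancel' hkl]

theorem HasType.isPDivisible {L : AddSubgroup V} {τ : GroupType} (hL : HasType L τ)
    {p : Nat.Primes} (hp : p ∈ τ.PInf) {x : V} (hx : x ∈ L) : IsPDivisible L p x := by
  by_cases h0 : x = 0
  · subst h0
    exact fun k => ⟨0, zero_mem _, by simp⟩
  · rw [← hL x hx h0, GroupType.mem_PInf_mk] at hp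
    exact isPDivisible_of_height_eq_top hp

/-- A group which is `p`-divisible for all `p ∈ P_∞(τ)` is an `R_τ`-module. -/
theorem ratRing_smul_mem {K : AddSubgroup V} {τ : GroupType}
    (hK : ∀ p ∈ τ.PInf, ∀ x ∈ K, ∃ y ∈ K, (p : ℕ) • y = x) {r : ℚ} (hr : r ∈ ratRing τ) {x : V}
    (hx : x ∈ K) : r • x ∈ K := by
  -- Division by a denominator is carried out one prime factor at a time.
  have key : ∀ n : ℕ, n ≠ 0 → (∀ p : Nat.Primes, (p : ℕ) ∣ n → p ∈ τ.PInf) →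
      ∀ x ∈ K, (n : ℚ)⁻¹ • x ∈ K := by
    intro n
    induction n using induction_on_primes with
    | zero => exact fun h => absurd rfl h
    | one => intro _ _ x hx; simpa using hx
    | prime_mul p a hp ih =>
      intro h0 hd x hx
      obtain ⟨y, hy, rfl⟩ := hK ⟨p, hp⟩ (hd ⟨p, hp⟩ (dvd_mul_right _ _)) x hx
      have := ih (right_ne_zero_of_mul h0) (fun q hq => hd q (hq.mul_left _)) y hy
      convert this using 1
      have hp0 : (p : ℚ) ≠ 0 := by exact_mod_cast hp.ne_zero
      rw [← Nat.cast_smul_eq_nsmul ℚ, smul_smul]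
      congr 1
      push_cast
      rw [mul_inv, mul_comm (p : ℚ)⁻¹, mul_assoc, inv_mul_cancel₀ hp0, mul_one]
  have h1 := zsmul_mem (key r.den r.den_nz hr x hx) r.num
  rw [← Int.cast_smul_eq_zsmul ℚ, smul_smul] at h1
  rwa [← div_eq_mul_inv, Rat.num_div_den] at h1

theorem inv_pow_mem_ratRing {τ : GroupType} {p : Nat.Primes} (hp : p ∈ τ.PInf) (k : ℕ) :
    ((p : ℚ) ^ k)⁻¹ ∈ ratRing τ := by
  rw [← inv_pow]
  refine pow_mem (fun q hq => ?_) k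
  rw [Rat.inv_natCast_den_of_pos p.2.pos, Nat.prime_dvd_prime_iff_eq q.2 p.2] at hq
  rwa [Nat.Primes.coe_nat_injective hq]

/-- The `p`-adic valuation is non-negative on `R_τ` when `p ∉ P_∞(τ)`, so a nonzero `q` would have
valuation at least every `k`. -/
theorem eq_zero_of_pow_dvd_ratRing {τ : GroupType} {p : Nat.Primes} (hp : p ∉ τ.PInf) {q : ℚ}
    (h : ∀ k : ℕ, ∃ r ∈ ratRing τ, q = (p : ℚ) ^ k * r) : q = 0 := by
  by_contra h0
  have : Fact (p : ℕ).Prime := ⟨p.2⟩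
  have key : ∀ k : ℕ, (k : ℤ) ≤ padicValRat p q := by
    intro k
    obtain ⟨r, hr, e⟩ := h k
    have hr0 : r ≠ 0 := by rintro rfl; simp [h0] at e
    have hp0 : (p : ℚ) ≠ 0 := by exact_mod_cast p.2.ne_zero
    have : padicValNat p r.den = 0 := padicValNat.eq_zero_of_not_dvd fun hd => hp (hr p hd)
    rw [e, padicValRat.mul (pow_ne_zero _ hp0) hr0, padicValRat.pow,
      padicValRat.self p.2.one_lt, padicValRat_def, this]
    simp
  have := key ((padicValRat p q).toNat + 1)
  push_cast at this
  have := Int.self_le_toNat (padicValRat p q)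
  omega

end Divisible

/-! ### Groups of rank one -/

section RankOne

variable {V : Type*} [AddCommGroup V] [Module ℚ V]

theorem exists_ne_zero_of_finrank_eq_one {L : AddSubgroup V} (h : Module.finrank ℤ L = 1) :
    ∃ x ∈ L, x ≠ 0 := by
  by_contra! hc
  have : Subsingleton L := ⟨fun a b => Subtype.ext ((hc a a.2).trans (hc b b.2).symm)⟩
  rw [Module.finrank_zero_of_subsingleton] at h
  exact zero_ne_one h

theorem exists_eq_smul_of_finrank_eq_one {L : AddSubgroup V} (h : Module.finrank ℤ L = 1)
    {x y : V} (hx : x ∈ L) (hx0 : x ≠ 0) (hy : y ∈ L) : ∃ q : ℚ, y = q • x := by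
  by_contra! hc
  have hlin : LinearIndependent ℤ ![x, y] := by
    rw [LinearIndependent.iff_fractionRing ℤ ℚ, LinearIndependent.pair_iff' hx0]
    exact fun a => (hc a).symm
  have hlin' : LinearIndependent ℤ (![⟨x, hx⟩, ⟨y, hy⟩] : Fin 2 → L) := by
    refine LinearIndependent.of_comp L.subtype.toIntLinearMap ?_
    convert hlin using 1
    ext i
    fin_cases i <;> rfl
  have := hlin'.cardinal_lift_le_rank
  rw [Module.rank_eq_one_iff_finrank_eq_one.2 h] at this
  simp at this

theorem finrank_inf_span_singleton {G : AddSubgroup V} {w : V} (hw : w ∈ G) (hw0 : w ≠ 0) :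
    Module.finrank ℤ (G ⊓ (Submodule.span ℚ {w}).toAddSubgroup : AddSubgroup V) = 1 := by
  set L := (G ⊓ (Submodule.span ℚ {w}).toAddSubgroup : AddSubgroup V) with hL
  rw [← Module.rank_eq_one_iff_finrank_eq_one]
  apply le_antisymm
  · let f : L →ₗ[ℤ] Submodule.span ℚ {w} :=
      (AddMonoidHom.mk' (fun x : L => (⟨x, x.2.2⟩ : Submodule.span ℚ {w}))
        (fun a b => rfl)).toIntLinearMap
    have hf : Function.Injective f := fun a b hab => Subtype.ext (congrArg Subtype.val hab :)
    refine (LinearMap.rank_le_of_injective f hf).trans ?_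
    rw [← IsLocalization.rank_eq ℚ (nonZeroDivisors ℤ) le_rfl]
    refine (rank_span_le _).trans ?_
    simp
  · have hlin : LinearIndependent ℤ (fun _ : Unit => (⟨w, hw, Submodule.mem_span_singleton_self w⟩ : L)) := by
      refine LinearIndependent.of_comp L.subtype.toIntLinearMap ?_
      rw [LinearIndependent.iff_fractionRing ℤ ℚ]
      exact linearIndependent_unique_iff (v := fun _ : Unit => w) |>.2 hw0
    simpa using hlin.cardinal_lift_le_rank

end RankOne

/-! ### Dual coordinates -/

section Dual

variable {V : Type*} [AddCommGroup V] [Module ℚ V] {ι : Type*} [Fintype ι] [DecidableEq ι]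

/-- The family need not span `V`, so `c` is arbitrary off the span. For this reason later statements
carry the expansion `x = ∑ i, c x i • v i` along with conditions on the coordinates. -/
theorem exists_dual {v : ι → V} (hv : LinearIndependent ℚ v) :
    ∃ c : V →ₗ[ℚ] (ι → ℚ), ∀ i, c (v i) = Pi.single i 1 := by
  obtain ⟨g, hg⟩ := LinearMap.exists_leftInverse_of_injective (Finsupp.linearCombination ℚ v)
    (LinearMap.ker_eq_bot.2 hv)
  refine ⟨Finsupp.lcoeFun ∘ₗ g, fun i => ?_⟩
  have := LinearMap.congr_fun hg (Finsupp.single i 1)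
  simp only [LinearMap.comp_apply, Finsupp.linearCombination_single, one_smul,
    LinearMap.id_apply] at this
  ext j
  simp [this, Finsupp.single_apply, Pi.single_apply, eq_comm]

theorem dual_sum {v : ι → V} {c : V →ₗ[ℚ] (ι → ℚ)} (hc : ∀ i, c (v i) = Pi.single i 1)
    (q : ι → ℚ) : c (∑ i, q i • v i) = q := by
  ext j
  simp [map_sum, hc, Finset.sum_apply, Pi.single_apply]

end Dual

/-! ### Decompositions into groups of rank one -/

section Decomposition

variable {V : Type*} [AddCommGroup V] [Module ℚ V]

/-- A nonzero element of each summand serves as a coordinate vector; the projection of `W` to `L l`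
then becomes the linear map `y ↦ d y l • w l`, defined on all of `V`. -/
theorem IsRankOneDecomposition.exists_dual {W : AddSubgroup V} {n : ℕ} {L : Fin n → AddSubgroup V}
    (h : IsRankOneDecomposition W L) :
    ∃ (w : Fin n → V) (d : V →ₗ[ℚ] (Fin n → ℚ)), (∀ l, w l ∈ L l) ∧
      (∀ l, d (w l) = Pi.single l 1) ∧
      ∀ y ∈ W, y = ∑ l, d y l • w l ∧ ∀ l, d y l • w l ∈ L l := by
  obtain ⟨h1, h2, h3⟩ := h
  choose w hw hw0 using fun l => exists_ne_zero_of_finrank_eq_one (h1 l)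
  have hlin : LinearIndependent ℚ w := by
    have : Module.IsTorsionFree ℤ V := .trans_faithfulSMul ℤ ℚ V
    rw [← LinearIndependent.iff_fractionRing ℤ ℚ]
    exact (h2.map_orderIso AddSubgroup.toIntSubmodule).linearIndependent _ hw hw0
  obtain ⟨d, hd⟩ := CRQ.exists_dual hlin
  refine ⟨w, d, hw, hd, fun y hy => ?_⟩
  rw [← h3] at hy
  induction hy using AddSubgroup.iSup_induction' with
  | hp l x hx =>
    obtain ⟨q, rfl⟩ := exists_eq_smul_of_finrank_eq_one (h1 l) (hw l) (hw0 l) hx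
    have e : ∀ l', d (q • w l) l' • w l' = if l' = l then q • w l else 0 := by
      intro l'
      rw [map_smul, hd]
      by_cases hl : l' = l
      · subst hl; simp
      · simp [hl]
    refine ⟨by simp only [e, Finset.sum_ite_eq', Finset.mem_univ, if_true], fun l' => ?_⟩
    rw [e]
    split_ifs with hl
    · rw [hl]; exact hx
    · exact zero_mem _
  | h1 => simp
  | hadd x y hx hy ihx ihy =>
    refine ⟨?_, fun l => ?_⟩
    · conv_lhs => rw [ihx.1, ihy.1]
      simp [add_smul, Finset.sum_add_distrib]
    · rw [map_add, Pi.add_apply, add_smul]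
      exact add_mem (ihx.2 l) (ihy.2 l)

theorem isCompletelyDecomposable_iSup_inf_span {ι : Type*} [Finite ι] {G : AddSubgroup V}
    {v : ι → V} (hv : LinearIndependent ℚ v) (hG : ∀ i, v i ∈ G) :
    IsCompletelyDecomposable (⨆ i, G ⊓ (Submodule.span ℚ {v i}).toAddSubgroup) := by
  classical
  have := Fintype.ofFinite ι
  obtain ⟨c, hc⟩ := exists_dual hv
  let e := (Fintype.equivFin ι).symm
  refine ⟨Fintype.card ι, fun l => G ⊓ (Submodule.span ℚ {v (e l)}).toAddSubgroup,
    fun l => finrank_inf_span_singleton (hG _) (hv.ne_zero _), ?_, ?_⟩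
  · have hind : iSupIndep fun i => G ⊓ (Submodule.span ℚ {v i}).toAddSubgroup := by
      intro i
      rw [disjoint_iff_inf_le]
      rintro x ⟨⟨-, hx⟩, hx'⟩
      have hle : (⨆ (j) (_ : j ≠ i), G ⊓ (Submodule.span ℚ {v j}).toAddSubgroup) ≤
          (LinearMap.ker (LinearMap.proj i ∘ₗ c)).toAddSubgroup := by
        refine iSup₂_le fun j hj y hy => ?_
        obtain ⟨q, rfl⟩ := Submodule.mem_span_singleton.1 hy.2
        simp [hc, hj.symm]
      obtain ⟨q, rfl⟩ := Submodule.mem_span_singleton.1 hx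
      have : q = 0 := by simpa [hc] using hle hx'
      simp [this]
    exact hind.comp e.injective
  · exact e.iSup_comp (g := fun i => G ⊓ (Submodule.span ℚ {v i}).toAddSubgroup)

theorem exists_nsmul_mem_of_relIndex_ne_zero {G W : AddSubgroup V} (h : W.relIndex G ≠ 0) :
    ∃ N : ℕ, N ≠ 0 ∧ ∀ x ∈ G, N • x ∈ W := by
  refine ⟨W.relIndex G, h, fun x hx => ?_⟩
  have := (W.addSubgroupOf G).nsmul_index_mem ⟨x, hx⟩
  rwa [AddSubgroup.mem_addSubgroupOf] at this

end Decomposition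

/-! ### Groups with a basis over the rings `R_τ` -/

section Frame

variable {V : Type*} [AddCommGroup V] [Module ℚ V] {ι : Type*}

/-- A fixed nonzero multiple of each `v i` lies in a completely decomposable group of finite rank
`n`, so the `v i` have independent coordinate vectors in `ℚⁿ`. Applied to an `A`-basis, this makes
all sums over it finite. -/
theorem finite_of_isACD {G : AddSubgroup V} (hG : IsACD G) {v : ι → V}
    (hv : LinearIndependent ℚ v) (hvG : ∀ i, v i ∈ G) : Finite ι := by
  obtain ⟨W, -, ⟨n, L, hL⟩, hidx⟩ := hG
  obtain ⟨N, hN, hNW⟩ := exists_nsmul_mem_of_relIndex_ne_zero hidx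
  obtain ⟨w, d, -, -, hd⟩ := hL.exists_dual
  have key : ∀ i, v i = Fintype.linearCombination ℚ w (d (v i)) := by
    intro i
    have h := (hd _ (hNW _ (hvG i))).1
    rw [← Nat.cast_smul_eq_nsmul ℚ] at h
    have hN' : (N : ℚ) ≠ 0 := by exact_mod_cast hN
    apply smul_right_injective V hN'
    simp only [Fintype.linearCombination_apply, Finset.smul_sum, smul_smul]
    simpa using h
  have : LinearIndependent ℚ (fun i => d (v i)) := by
    refine LinearIndependent.of_comp (Fintype.linearCombination ℚ w) ?_
    convert hv using 1
    ext i
    exact (key i).symm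
  exact this.finite

variable [Fintype ι]

theorem exists_integer_multiple (q : ι → ℚ) :
    ∃ n : ℕ, n ≠ 0 ∧ ∃ z : ι → ℤ, ∀ i, (n : ℚ) * q i = z i := by
  classical
  refine ⟨∏ i, (q i).den, Finset.prod_ne_zero_iff.2 fun i _ => (q i).den_nz,
    fun i => (∏ j ∈ Finset.univ.erase i, ((q j).den : ℤ)) * (q i).num, fun i => ?_⟩
  rw [← Finset.mul_prod_erase Finset.univ _ (Finset.mem_univ i)]
  push_cast
  have : ((q i).den : ℚ) * q i = (q i).num := Rat.den_mul_eq_num (q i)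
  linear_combination (∏ j ∈ Finset.univ.erase i, ((q j).den : ℚ)) * this

/-- A homomorphism to a rational vector space extends linearly to the divisible hull. -/
theorem map_eq_sum_smul {G : AddSubgroup V} (f : G →+ V) (v : ι → G) {q : ι → ℚ} {x : G}
    (hx : (x : V) = ∑ i, q i • (v i : V)) : f x = ∑ i, q i • f (v i) := by
  obtain ⟨n, hn, z, hz⟩ := exists_integer_multiple q
  have hn' : (n : ℚ) ≠ 0 := by exact_mod_cast hn
  have h1 : n • x = ∑ i, z i • v i := by
    apply Subtype.ext
    push_cast
    rw [hx, ← Nat.cast_smul_eq_nsmul ℚ, Finset.smul_sum]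
    refine Finset.sum_congr rfl fun i _ => ?_
    rw [smul_smul, hz, Int.cast_smul_eq_zsmul]
  apply smul_right_injective V hn'
  have h2 := congrArg f h1
  rw [map_nsmul, map_sum] at h2
  simp only [Nat.cast_smul_eq_nsmul]
  rw [h2, ← Nat.cast_smul_eq_nsmul ℚ, Finset.smul_sum]
  refine Finset.sum_congr rfl fun i _ => ?_
  rw [smul_smul, hz, Int.cast_smul_eq_zsmul, map_zsmul]

variable [DecidableEq ι]

/-- `A` is the direct sum of the groups `R_{t i} v_i`, the linear map `c` gives the coordinates
with respect to `v`, and distinct types among the `t i` are incomparable. -/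
structure IsFrame (A : AddSubgroup V) (t : ι → GroupType) (v : ι → V) (c : V →ₗ[ℚ] (ι → ℚ)) :
    Prop where
  dual : ∀ i, c (v i) = Pi.single i 1
  mem_iff : ∀ x, x ∈ A ↔ x = ∑ i, c x i • v i ∧ ∀ i, c x i ∈ ratRing (t i)
  incomparable : ∀ i j, (t i).PInf ⊆ (t j).PInf → t j = t i

/-- `x` has nonzero coordinates only at indices of type `τ`. -/
def IsSupported (t : ι → GroupType) (c : V →ₗ[ℚ] (ι → ℚ)) (τ : GroupType) (x : V) : Prop :=
  ∀ j, t j ≠ τ → c x j = 0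

variable {A G : AddSubgroup V} {t : ι → GroupType} {v : ι → V} {c : V →ₗ[ℚ] (ι → ℚ)}

namespace IsFrame

theorem sum_mem (F : IsFrame A t v c) {q : ι → ℚ} (hq : ∀ i, q i ∈ ratRing (t i)) :
    ∑ i, q i • v i ∈ A := by
  rw [F.mem_iff, dual_sum F.dual]
  exact ⟨rfl, hq⟩

theorem smul_mem (F : IsFrame A t v c) {i : ι} {q : ℚ} (hq : q ∈ ratRing (t i)) :
    q • v i ∈ A := by
  have := F.sum_mem (q := Pi.single i q) fun j => by
    by_cases h : j = i
    · subst h; simpa using hq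
    · simp [h, zero_mem]
  simpa [Pi.single_apply] using this

theorem mem (F : IsFrame A t v c) (i : ι) : v i ∈ A := by
  simpa using F.smul_mem (i := i) (one_mem _)

theorem linearIndependent (F : IsFrame A t v c) : LinearIndependent ℚ v := by
  rw [Fintype.linearIndependent_iff]
  intro g hg i
  have := dual_sum F.dual g
  rw [hg, map_zero] at this
  rw [← this]; rfl

theorem eq_sum (F : IsFrame A t v c) {N : ℕ} (hN : N ≠ 0) {x : V} (hx : N • x ∈ A) :
    x = ∑ i, c x i • v i := by
  have h := ((F.mem_iff _).1 hx).1
  rw [← Nat.cast_smul_eq_nsmul ℚ] at h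
  have hN' : (N : ℚ) ≠ 0 := by exact_mod_cast hN
  apply smul_right_injective V hN'
  simp only [Finset.smul_sum, smul_smul]
  simpa using h

theorem coord_eq_zero (F : IsFrame A t v c) {N : ℕ} (hN : N ≠ 0) (hNG : ∀ x ∈ G, N • x ∈ A)
    {p : Nat.Primes} {x : V} (hx : IsPDivisible G p x) {i : ι} (hp : p ∉ (t i).PInf) :
    c x i = 0 := by
  have hN' : (N : ℚ) ≠ 0 := by exact_mod_cast hN
  have : (N : ℚ) * c x i = 0 := by
    refine eq_zero_of_pow_dvd_ratRing hp fun k => ?_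
    obtain ⟨y, hy, rfl⟩ := hx k
    refine ⟨_, ((F.mem_iff _).1 (hNG y hy)).2 i, ?_⟩
    simp
    ring
  exact (mul_eq_zero.1 this).resolve_left hN'

/-- A nonzero coordinate at `j` forces `P_∞(τ) ⊆ P_∞(t j)`, and then `t j = τ` by incomparability.
Divisibility is only asked for in `G`, so the lemma applies to images under homomorphisms into `G`.
-/
theorem isSupported (F : IsFrame A t v c) {N : ℕ} (hN : N ≠ 0) (hNG : ∀ x ∈ G, N • x ∈ A)
    {τ : GroupType} (hτ : ∀ j, τ.PInf ⊆ (t j).PInf → t j = τ) {x : V}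
    (hx : ∀ p ∈ τ.PInf, IsPDivisible G p x) : IsSupported t c τ x := by
  intro j hj
  by_contra h0
  refine hj (hτ j fun p hp => ?_)
  by_contra hpj
  exact h0 (F.coord_eq_zero hN hNG (hx p hp) hpj)

theorem isPDivisible (F : IsFrame A t v c) {i : ι} {p : Nat.Primes} (hp : p ∈ (t i).PInf) :
    IsPDivisible A p (v i) := by
  intro k
  refine ⟨_, F.smul_mem (inv_pow_mem_ratRing hp k), ?_⟩
  have hp0 : (p : ℚ) ≠ 0 := by exact_mod_cast p.2.ne_zero
  rw [← Nat.cast_smul_eq_nsmul ℚ, smul_smul]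
  push_cast
  rw [mul_inv_cancel₀ (pow_ne_zero _ hp0), one_smul]

/-- The elements of `A` supported on one type are closed under multiplication by `R_τ`. -/
theorem ratRing_smul_mem (F : IsFrame A t v c) {τ : GroupType} {x : V} (hx : x ∈ A)
    (hs : IsSupported t c τ x) {r : ℚ} (hr : r ∈ ratRing τ) : r • x ∈ A := by
  obtain ⟨h1, h2⟩ := (F.mem_iff x).1 hx
  rw [h1, Finset.smul_sum]
  simp only [smul_smul]
  refine F.sum_mem fun i => ?_
  by_cases h : t i = τ
  · exact mul_mem (h ▸ hr) (h2 i)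
  · rw [hs i h, mul_zero]
    exact zero_mem _

/-- In a decomposition of a subgroup of finite index into groups of rank one, each summand is
supported on one type. -/
theorem exists_isSupported (F : IsFrame A t v c) (hAG : A ≤ G) {N : ℕ} (hN : N ≠ 0)
    (hNG : ∀ x ∈ G, N • x ∈ A) {W : AddSubgroup V} (hWG : W ≤ G) (hW : W.relIndex G ≠ 0) {n : ℕ}
    {L : Fin n → AddSubgroup V} (hL : IsRankOneDecomposition W L) (l : Fin n) :
    ∃ τ, ∀ x ∈ L l, IsSupported t c τ x := by
  obtain ⟨M, hM, hMW⟩ := exists_nsmul_mem_of_relIndex_ne_zero hW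
  have hM' : (M : ℚ) ≠ 0 := by exact_mod_cast hM
  obtain ⟨w, d, hw, hdw, hd⟩ := hL.exists_dual
  have hLW : ∀ l, L l ≤ W := fun l => hL.2.2 ▸ le_iSup L l
  -- Some basis vector has a nonzero component in `L l`, since `w l` is a combination of basis
  -- vectors. The component of a multiple of it inherits the divisibility of `v i`, and by rank one
  -- it determines the support of all of `L l`.
  have hex : ∃ i, d (v i) l ≠ 0 := by
    by_contra! h
    have h1 := F.eq_sum hN (hNG _ (hWG (hLW l (hw l))))
    have h2 := congrFun (congrArg d h1) l
    rw [hdw, map_sum, Finset.sum_apply] at h2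
    simp [h] at h2
  obtain ⟨i, hi⟩ := hex
  set z := d (M • v i) l • w l with hz
  have hz0 : d (M • v i) l ≠ 0 := by
    rw [map_nsmul, Pi.smul_apply, nsmul_eq_mul]
    exact mul_ne_zero hM' hi
  have hs : IsSupported t c (t i) z := by
    refine F.isSupported hN hNG (F.incomparable i) fun p hp k => ?_
    obtain ⟨y, hy, e⟩ := F.isPDivisible hp k
    refine ⟨_, hWG (hLW l ((hd _ (hMW y (hAG hy))).2 l)), ?_⟩
    rw [hz, ← e]
    rw [← Nat.cast_smul_eq_nsmul ℚ, smul_smul]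
    congr 1
    simp only [map_nsmul, Pi.smul_apply]
    simp only [nsmul_eq_mul]
    ring
  refine ⟨t i, fun x hx j hj => ?_⟩
  have hw0 : w l ≠ 0 := fun h => by
    have := congrFun (hdw l) l
    simp [h] at this
  obtain ⟨q, rfl⟩ := exists_eq_smul_of_finrank_eq_one (hL.1 l) (hw l) hw0 hx
  have h3 := hs j hj
  rw [hz, map_smul, Pi.smul_apply, smul_eq_mul] at h3
  rw [map_smul, Pi.smul_apply, (mul_eq_zero.1 h3).resolve_left hz0, smul_zero]

theorem exists_nsmul_mem (F : IsFrame A t v c) {d : V} (hd : AddSubgroup.zmultiples d ⊔ A = G)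
    (hds : d = ∑ i, c d i • v i) : ∃ N : ℕ, N ≠ 0 ∧ ∀ x ∈ G, N • x ∈ A := by
  obtain ⟨n, hn, z, hz⟩ := exists_integer_multiple (c d)
  refine ⟨n, hn, fun x hx => ?_⟩
  rw [← hd, AddSubgroup.mem_sup] at hx
  obtain ⟨y, hy, a, ha, rfl⟩ := hx
  obtain ⟨k, rfl⟩ := AddSubgroup.mem_zmultiples_iff.1 hy
  rw [nsmul_add]
  refine add_mem ?_ (nsmul_mem ha n)
  rw [smul_comm]
  refine zsmul_mem ?_ k
  rw [hds, ← Nat.cast_smul_eq_nsmul ℚ, Finset.smul_sum]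
  simp only [smul_smul, hz]
  exact F.sum_mem fun i => intCast_mem _ _

/-- The homogeneous components of the regulator are pure. -/
theorem mem_reg_of_isSupported (F : IsFrame (reg G) t v c) (hG : IsACD G) {d : V}
    (hd : GeneratesRegQuotient G d) (hds : d = ∑ i, c d i • v i)
    (hdu : ∀ i j, t i = t j → c d i ≠ 0 → c d j ≠ 0 → i = j) {τ : GroupType} {x : V} (hx : x ∈ G)
    (hs : IsSupported t c τ x) : x ∈ reg G := by
  obtain ⟨N, hN, hNG⟩ := F.exists_nsmul_mem hd hds
  have hAG : reg G ≤ G := le_sup_right.trans_eq hd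
  -- This group will contain every completely decomposable subgroup of finite index and be one
  -- itself. Hence it is the only one of lowest index and is contained in the regulator.
  set W' : AddSubgroup V := ⨆ i, G ⊓ (Submodule.span ℚ {v i}).toAddSubgroup with hW'
  have hW'G : W' ≤ G := iSup_le fun i => inf_le_left
  have hmem : ∀ y i, y ∈ G → (∃ q : ℚ, y = q • v i) → y ∈ W' := by
    rintro y i hy ⟨q, rfl⟩
    exact le_iSup (fun i => G ⊓ (Submodule.span ℚ {v i}).toAddSubgroup) i
      ⟨hy, Submodule.smul_mem _ _ (Submodule.mem_span_singleton_self _)⟩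
  have hsupp : ∀ σ, ∀ y ∈ G, IsSupported t c σ y → y ∈ W' := by
    intro σ y hy hys
    have hy1 : y = ∑ i, c y i • v i := F.eq_sum hN (hNG y hy)
    -- Modulo `A`, `y` is a multiple of `d`, so where `d` has no coordinate, that of `y` comes from
    -- `A`. At most one index of type `σ` remains; its term is `y` minus the other terms.
    have hreg : ∀ i, c d i = 0 → c y i • v i ∈ G := by
      intro i hi
      have hy2 := hy
      rw [← hd, AddSubgroup.mem_sup] at hy2
      obtain ⟨y', hy', a, ha, rfl⟩ := hy2
      obtain ⟨k, rfl⟩ := AddSubgroup.mem_zmultiples_iff.1 hy'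
      rw [map_add, map_zsmul, Pi.add_apply, Pi.smul_apply, hi, smul_zero, zero_add]
      exact hAG (F.smul_mem (((F.mem_iff a).1 ha).2 i))
    have hall : ∀ i, c y i • v i ∈ G := by
      intro i
      by_cases hi : c d i = 0
      · exact hreg i hi
      by_cases hti : t i = σ
      · have : c y i • v i = y - ∑ j ∈ Finset.univ.erase i, c y j • v j := by
          rw [eq_sub_iff_add_eq, Finset.add_sum_erase _ (fun j => c y j • v j) (Finset.mem_univ i)]
          exact hy1.symm
        rw [this]
        refine sub_mem hy (_root_.sum_mem fun j hj => ?_)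
        by_cases hj' : c d j = 0
        · exact hreg j hj'
        by_cases htj : t j = σ
        · exact absurd (hdu j i (htj.trans hti.symm) hj' hi) (Finset.ne_of_mem_erase hj)
        · rw [hys j htj, zero_smul]
          exact zero_mem _
      · rw [hys i hti, zero_smul]
        exact zero_mem _
    rw [hy1]
    exact _root_.sum_mem fun i _ => hmem _ i (hall i) ⟨_, rfl⟩
  have hle : ∀ W, IsCDSubgroup G W → W ≤ W' := by
    rintro W ⟨hWG, ⟨n, L, hL⟩, hidx⟩
    rw [← hL.2.2]
    refine iSup_le fun l => ?_
    obtain ⟨σ, hσ⟩ := F.exists_isSupported hAG hN hNG hWG hidx hL l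
    have hLW : L l ≤ W := hL.2.2 ▸ le_iSup L l
    exact fun y hy => hsupp σ y (hWG (hLW hy)) (hσ y hy)
  have hcd : IsCDSubgroup G W' := by
    obtain ⟨W, hW⟩ := hG
    exact ⟨hW'G, isCompletelyDecomposable_iSup_inf_span F.linearIndependent
      fun i => hAG (F.mem i), fun h0 => hW.2.2 (Nat.eq_zero_of_zero_dvd
        (h0 ▸ AddSubgroup.relIndex_dvd_of_le_left G (hle W hW)))⟩
  have hW'A : W' ≤ reg G := by
    refine le_sInf ?_
    rintro W ⟨hW, hmin⟩
    -- `W ≤ W' ≤ G` and minimality of the index of `W` force `W` to have index 1 in `W'`.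
    have h1 := AddSubgroup.relIndex_mul_relIndex W W' G (hle W hW) hW'G
    have h2 := hmin W' hcd
    have h3 := hW.2.2
    rw [← h1] at h2 h3
    rw [← AddSubgroup.relIndex_eq_one]
    have h4 := Nat.pos_of_ne_zero (right_ne_zero_of_mul h3)
    have h5 := Nat.pos_of_ne_zero (left_ne_zero_of_mul h3)
    have h6 : W.relIndex W' ≤ 1 := by
      by_contra! h
      nlinarith
    omega
  exact hW'A (hsupp τ x hx hs)

end IsFrame

end Frame

/-! ### Congruences modulo `m` and `m²` -/

section Congruences

variable {V : Type*} [AddCommGroup V] [Module ℚ V]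

theorem mem_mulSubgroup_iff {n : ℕ} (hn : n ≠ 0) {K : AddSubgroup V} {x : V} :
    x ∈ mulSubgroup n K ↔ (1 / n : ℚ) • x ∈ K := by
  have hn' : (n : ℚ) ≠ 0 := by exact_mod_cast hn
  constructor
  · rintro ⟨y, hy, rfl⟩
    have : (1 / n : ℚ) • nsmulAddMonoidHom n y = y := by
      rw [nsmulAddMonoidHom_apply, ← Nat.cast_smul_eq_nsmul ℚ, smul_smul,
        one_div_mul_cancel hn', one_smul]
    rwa [this]
  · intro h
    refine ⟨_, h, ?_⟩
    rw [nsmulAddMonoidHom_apply, ← Nat.cast_smul_eq_nsmul ℚ, smul_smul, mul_one_div_cancel hn',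
      one_smul]

variable {K : AddSubgroup V} {s t z k : ℤ} {m : ℕ} {u e : V}

theorem intCast_smul_mem (n : ℤ) {x : V} (hx : x ∈ K) : (n : ℚ) • x ∈ K := by
  rw [Int.cast_smul_eq_zsmul]
  exact zsmul_mem hx n

/-- Dividing the Bézout relation by `m` gives `1/m = t (s/m) + z`. -/
theorem one_div_smul_mem (hm : m ≠ 0) (h : s * t + m * z = 1) (hu : u ∈ K)
    (hsu : ((s : ℚ) / m) • u ∈ K) : (1 / m : ℚ) • u ∈ K := by
  have hm' : (m : ℚ) ≠ 0 := by exact_mod_cast hm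
  have h' : (s : ℚ) * t + m * z = 1 := by exact_mod_cast h
  have : (1 / m : ℚ) • u = (t : ℚ) • ((s : ℚ) / m) • u + (z : ℚ) • u := by
    rw [smul_smul, ← add_smul]
    congr 1
    field_simp
    linear_combination -h'
  rw [this]
  exact add_mem (intCast_smul_mem t hsu) (intCast_smul_mem z hu)

/-- From `(st)² = (1 - mz)²` one gets `1/m² = t² (s/m)² + (2z - z²m)/m`. The last term is harmless
because `u/m ∈ K`, and the multiples of `e` differ by the integral amount `ktz`. -/
theorem one_div_sq_smul_mem (hm : m ≠ 0) (h : s * t + m * z = 1) (he : e ∈ K)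
    (hu : (1 / m : ℚ) • u ∈ K)
    (hsu : ((s : ℚ) / m * (s / m)) • u - (k : ℚ) • ((s : ℚ) / m) • e ∈ K) :
    (1 / (m : ℚ) ^ 2) • (u - (k : ℚ) • (m * t : ℚ) • e) ∈ K := by
  have hm' : (m : ℚ) ≠ 0 := by exact_mod_cast hm
  have h' : (s : ℚ) * t + m * z = 1 := by exact_mod_cast h
  have : (1 / (m : ℚ) ^ 2) • (u - (k : ℚ) • (m * t : ℚ) • e) =
      ((t ^ 2 : ℤ) : ℚ) • (((s : ℚ) / m * (s / m)) • u - (k : ℚ) • ((s : ℚ) / m) • e) +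
      ((2 * z - z ^ 2 * m : ℤ) : ℚ) • (1 / m : ℚ) • u - ((k * t * z : ℤ) : ℚ) • e := by
    match_scalars
    · field_simp
      linear_combination (-1 - (s : ℚ) * t + m * z) * h'
    · field_simp
      linear_combination (k : ℚ) * t * h'
  rw [this]
  exact sub_mem (add_mem (intCast_smul_mem _ hsu) (intCast_smul_mem _ hu)) (intCast_smul_mem _ he)

/-- Multiplication by `s²` reverses the preceding step, as `s²t/m = s/m - sz`. -/
theorem mul_smul_sub_smul_mem (hm : m ≠ 0) (h : s * t + m * z = 1) (he : e ∈ K)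
    (hu : (1 / (m : ℚ) ^ 2) • (u - (k : ℚ) • (m * t : ℚ) • e) ∈ K) :
    ((s : ℚ) / m * (s / m)) • u - (k : ℚ) • ((s : ℚ) / m) • e ∈ K := by
  have hm' : (m : ℚ) ≠ 0 := by exact_mod_cast hm
  have h' : (s : ℚ) * t + m * z = 1 := by exact_mod_cast h
  have : ((s : ℚ) / m * (s / m)) • u - (k : ℚ) • ((s : ℚ) / m) • e =
      ((s ^ 2 : ℤ) : ℚ) • (1 / (m : ℚ) ^ 2) • (u - (k : ℚ) • (m * t : ℚ) • e) -
      ((k * s * z : ℤ) : ℚ) • e := by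
    match_scalars
    · field_simp
    · field_simp
      linear_combination ((k : ℚ) * s) * h'
  rw [this]
  exact sub_mem (intCast_smul_mem _ hu) (intCast_smul_mem _ he)

end Congruences

/-! ### Bases of block-rigid groups of ring type -/

section Component

variable {V : Type*} [AddCommGroup V] [Module ℚ V] {ι : Type*} [Fintype ι] [DecidableEq ι]
  {A : AddSubgroup V} {t : ι → GroupType} {v : ι → V} {c : V →ₗ[ℚ] (ι → ℚ)}

/-- The rank one groups generating the component are `p`-divisible for `p ∈ P_∞(τ)`, hence so is
their sum. -/
theorem component_smul_mem {τ : GroupType} {r : ℚ} (hr : r ∈ ratRing τ) {x : V}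
    (hx : x ∈ component A τ) : r • x ∈ component A τ := by
  refine ratRing_smul_mem (fun p hp y hy => ?_) hr hx
  have hle : component A τ ≤ (component A τ).map (nsmulAddMonoidHom (p : ℕ)) := by
    refine iSup_le fun n => iSup_le fun L => iSup_le fun hL => iSup_le fun i => iSup_le fun hi => ?_
    intro w hw
    obtain ⟨w', hw', e⟩ := hi.isPDivisible hp hw 1
    have hLA : L i ≤ component A τ := by
      unfold component
      exact le_iSup_of_le n <| le_iSup_of_le L <| le_iSup_of_le hL <| le_iSup_of_le i <|
        le_iSup_of_le hi le_rfl
    exact ⟨w', hLA hw', by simpa using e⟩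
  obtain ⟨w, hw, e⟩ := hle hy
  exact ⟨w, hw, e⟩

/-- Summands of type `τ` in any decomposition are supported on `τ` by their divisibility, so the sum
over all decompositions yields nothing beyond the span of the frame vectors of type `τ`. -/
theorem IsFrame.mem_component_iff (F : IsFrame A t v c) {τ : GroupType}
    (hτ : ∀ j, τ.PInf ⊆ (t j).PInf → t j = τ) (hv : ∀ i, t i = τ → v i ∈ component A τ) {x : V} :
    x ∈ component A τ ↔ x ∈ A ∧ IsSupported t c τ x := by
  constructor
  · let S : AddSubgroup V :=
      { carrier := {x | x ∈ A ∧ IsSupported t c τ x}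
        add_mem' := fun hx hy => ⟨add_mem hx.1 hy.1, fun j hj => by
          simp [hx.2 j hj, hy.2 j hj]⟩
        zero_mem' := ⟨zero_mem _, fun j _ => by simp⟩
        neg_mem' := fun hx => ⟨neg_mem hx.1, fun j hj => by simp [hx.2 j hj]⟩ }
    have hle : component A τ ≤ S := by
      refine iSup_le fun n => iSup_le fun L => iSup_le fun hL => iSup_le fun i => iSup_le fun hi => ?_
      have hLA : L i ≤ A := hL.2.2 ▸ le_iSup L i
      refine fun w hw => ⟨hLA hw, F.isSupported one_ne_zero (fun y hy => ?_) hτ fun p hp =>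
        (hi.isPDivisible hp hw).mono hLA⟩
      rwa [one_nsmul]
    exact fun hx => hle hx
  · rintro ⟨hx, hs⟩
    obtain ⟨h1, h2⟩ := (F.mem_iff x).1 hx
    rw [h1]
    refine _root_.sum_mem fun i _ => ?_
    by_cases h : t i = τ
    · exact component_smul_mem (h ▸ h2 i) (hv i h)
    · rw [hs i h, zero_smul]
      exact zero_mem _

end Component

/-- This turns the sum over `T(B)` in a standard representation into a sum over the whole `A`-basis.
-/
theorem finsum_mem_eq_sum_sigma {α V : Type*} [AddCommMonoid V] {T T' : Set α} {I : α → Finset ℕ}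
    (hT : T' ⊆ T) (hI : ∀ τ, 0 ∈ I τ ↔ τ ∈ T') [Fintype (Σ τ : T, I (τ : α))] (f : α → V) :
    ∑ᶠ τ ∈ T', f τ = ∑ x : Σ τ : T, I (τ : α), if (x.2 : ℕ) = 0 then f x.1 else 0 := by
  let o : T' → Σ τ : T, I (τ : α) := fun τ => ⟨⟨τ, hT τ.2⟩, ⟨0, (hI τ).2 τ.2⟩⟩
  have ho : Function.Injective o := fun τ σ h =>
    Subtype.ext (congrArg (fun x : Σ τ : T, I (τ : α) => (x.1 : α)) h :)
  have : Fintype T' := Fintype.ofInjective o ho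
  rw [← finsum_set_coe_eq_finsum_mem, finsum_eq_sum_of_fintype]
  refine Fintype.sum_of_injective o ho _ _ (fun x hx => if_neg fun h0 => hx ?_) fun τ =>
    (if_pos rfl).symm
  obtain ⟨τ, i, hi⟩ := x
  simp only at h0
  subst h0
  exact ⟨⟨τ, (hI τ).1 hi⟩, rfl⟩

section Basis

variable {V : Type*} [AddCommGroup V] [Module ℚ V] {G G₁ C : AddSubgroup V}
  {e : GroupType → ℕ → V}

/-- The set of all pairs `(τ, i)` with `τ ∈ T(G)` and `i ∈ I_τ`. -/
abbrev BasisIndex (G G₁ C : AddSubgroup V) : Type := Σ τ : critTypes G, idx G₁ C (τ : GroupType)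

theorem eq_of_PInf_subset (hrigid : IsBlockRigid G) (hring : IsOfRingType G) {τ σ : GroupType}
    (hτ : τ ∈ critTypes G) (hσ : σ ∈ critTypes G) (h : τ.PInf ⊆ σ.PInf) : σ = τ := by
  by_contra hne
  exact hrigid hτ hσ (Ne.symm hne) ((hring τ hτ).le_of_PInf_subset h)

theorem IsABasis.exists_isFrame [Fintype (BasisIndex G G₁ C)] [DecidableEq (BasisIndex G G₁ C)]
    (he : IsABasis G G₁ C e)
    (hrigid : IsBlockRigid G) (hring : IsOfRingType G) :
    ∃ c : V →ₗ[ℚ] (BasisIndex G G₁ C → ℚ),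
      IsFrame (reg G) (fun x : BasisIndex G G₁ C => (x.1 : GroupType)) (fun x => e x.1 x.2) c := by
  obtain ⟨c, hc⟩ := exists_dual he.linearIndependent
  refine ⟨c, hc, fun x => ⟨fun hx => ?_, fun hx => ?_⟩, fun i j h =>
    eq_of_PInf_subset hrigid hring i.1.2 j.1.2 h⟩
  · rw [← he.closure_eq] at hx
    induction hx using AddSubgroup.closure_induction with
    | mem x hx =>
      obtain ⟨τ, hτ, i, hi, r, hr, rfl⟩ := hx
      have h := hc ⟨⟨τ, hτ⟩, ⟨i, hi⟩⟩
      simp only at h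
      rw [map_smul, h]
      refine ⟨by simp [Pi.single_apply], fun j => ?_⟩
      by_cases hj : j = ⟨⟨τ, hτ⟩, ⟨i, hi⟩⟩
      · subst hj; simpa using hr
      · simp [hj, zero_mem]
    | zero => exact ⟨by simp, fun i => by simp [zero_mem]⟩
    | add x y _ _ hx hy =>
      refine ⟨?_, fun i => by simpa using add_mem (hx.2 i) (hy.2 i)⟩
      conv_lhs => rw [hx.1, hy.1]
      simp [add_smul, Finset.sum_add_distrib]
    | neg x _ hx =>
      refine ⟨?_, fun i => by simpa using hx.2 i⟩
      conv_lhs => rw [hx.1]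
      simp
  · rw [← he.closure_eq, hx.1]
    exact _root_.sum_mem fun i _ => AddSubgroup.subset_closure
      ⟨i.1, i.1.2, i.2, i.2.2, _, hx.2 i, rfl⟩

theorem zero_mem_idx {τ : GroupType} : 0 ∈ idx G₁ C τ ↔ τ ∈ critTypes G₁ := by
  unfold idx
  split_ifs with h <;> simp [h]

theorem isBot_iff {τ : GroupType} (hτ : τ ∈ critTypes G₁) {i : idx G₁ C τ} :
    IsBot i ↔ (i : ℕ) = 0 := by
  constructor
  · intro h
    exact Nat.le_zero.1 (h ⟨0, zero_mem_idx.2 hτ⟩)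
  · intro h j
    change (i : ℕ) ≤ j
    omega

theorem stdCoeff_isStandardRep {e₀ : GroupType → V} {d : V} (hd : d ∈ genSetOf G G₁ e₀) :
    IsStandardRep G G₁ e₀ d (stdCoeff G G₁ e₀ d) := by
  unfold stdCoeff
  have h : ∃ s : GroupType → ℤ, IsStandardRep G G₁ e₀ d s := hd
  rw [dif_pos h]
  exact h.choose_spec

theorem stdCoeff_bezout {e₀ : GroupType → V} {d : V} (hd : d ∈ genSetOf G G₁ e₀) {τ : GroupType}
    (hτ : τ ∈ critTypes G₁) :
    stdCoeff G G₁ e₀ d τ * Int.gcdA (stdCoeff G G₁ e₀ d τ) (mInv G τ) +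
      (mInv G τ : ℕ) * Int.gcdB (stdCoeff G G₁ e₀ d τ) (mInv G τ) = 1 := by
  have h1 := Int.gcd_eq_gcd_ab (stdCoeff G G₁ e₀ d τ) (mInv G τ)
  rw [Int.isCoprime_iff_gcd_eq_one.1 ((stdCoeff_isStandardRep hd).coprime τ hτ)] at h1
  exact_mod_cast h1.symm

theorem mem_critTypes_of_snd_eq_zero {x : BasisIndex G G₁ C} (h : (x.2 : ℕ) = 0) :
    (x.1 : GroupType) ∈ critTypes G₁ := by
  rw [← zero_mem_idx (C := C), ← h]
  exact x.2.2

theorem basisIndex_ext {x y : BasisIndex G G₁ C} (h1 : (x.1 : GroupType) = y.1)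
    (h2 : (x.2 : ℕ) = y.2) : x = y := by
  obtain ⟨⟨τ, hτ⟩, ⟨i, hi⟩⟩ := x
  obtain ⟨⟨σ, hσ⟩, ⟨j, hj⟩⟩ := y
  simp only at h1 h2
  subst h1 h2
  rfl

/-- The coordinates of an element with a standard representation. -/
theorem IsStandardRep.coord_eq [Fintype (BasisIndex G G₁ C)] [DecidableEq (BasisIndex G G₁ C)]
    (hmain : IsMainDecomposition G G₁ C) {c : V →ₗ[ℚ] (BasisIndex G G₁ C → ℚ)}
    (hc : ∀ x : BasisIndex G G₁ C, c (e x.1 x.2) = Pi.single x 1) {d : V} {s : GroupType → ℤ}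
    (h : IsStandardRep G G₁ (fun τ => e τ 0) d s) :
    (∀ x, c d x = if (x.2 : ℕ) = 0 then (s x.1 : ℚ) / mInv G x.1 else 0) ∧
      d = ∑ x, c d x • e x.1 x.2 := by
  let q : BasisIndex G G₁ C → ℚ := fun x => if (x.2 : ℕ) = 0 then (s x.1 : ℚ) / mInv G x.1 else 0
  have h1 : d = ∑ x : BasisIndex G G₁ C, q x • e x.1 x.2 := by
    refine h.eq_sum.trans ((finsum_mem_eq_sum_sigma (I := idx G₁ C)
      (fun τ hτ => ((hmain.mem_critTypes_iff τ).1 hτ).1) (fun τ => zero_mem_idx) _).trans ?_)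
    refine Finset.sum_congr rfl fun x _ => ?_
    by_cases h0 : (x.2 : ℕ) = 0
    · simp only [q, h0, if_true]
    · simp only [q, if_neg h0, zero_smul]
  have h2 : c d = q := (congrArg c h1).trans (dual_sum hc q)
  exact ⟨fun x => congrFun h2 x, by rw [h2]; exact h1⟩

theorem IsABasis.mem_regComponent_iff [Fintype (BasisIndex G G₁ C)]
    [DecidableEq (BasisIndex G G₁ C)] (he : IsABasis G G₁ C e)
    (hrigid : IsBlockRigid G) (hring : IsOfRingType G) {c : V →ₗ[ℚ] (BasisIndex G G₁ C → ℚ)}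
    (F : IsFrame (reg G) (fun x : BasisIndex G G₁ C => (x.1 : GroupType)) (fun x => e x.1 x.2) c)
    {τ : GroupType} (hτ : τ ∈ critTypes G) {x : V} :
    x ∈ regComponent G τ ↔ x ∈ reg G ∧
      IsSupported (fun x : BasisIndex G G₁ C => (x.1 : GroupType)) c τ x := by
  refine F.mem_component_iff (fun j h => eq_of_PInf_subset hrigid hring hτ j.1.2 h) ?_
  rintro ⟨⟨σ, hσ⟩, ⟨i, hi⟩⟩ h
  simp only at h
  subst h
  exact he.mem σ hσ i hi

end Basis

/-! ### The invariants `m_τ` and the groups `M(d, E₀)` -/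

section Invariants

variable {V : Type*} [AddCommGroup V] [Module ℚ V] {G G₁ C : AddSubgroup V}
  {e : GroupType → ℕ → V}

theorem GeneratesRegQuotient.exists_eq {d x : V} (hd : GeneratesRegQuotient G d) (hx : x ∈ G) :
    ∃ k : ℤ, ∃ a ∈ reg G, x = k • d + a := by
  rw [← hd, AddSubgroup.mem_sup] at hx
  obtain ⟨y, hy, a, ha, rfl⟩ := hx
  obtain ⟨k, rfl⟩ := AddSubgroup.mem_zmultiples_iff.1 hy
  exact ⟨k, a, ha, rfl⟩

theorem GeneratesRegQuotient.mem {d : V} (hd : GeneratesRegQuotient G d) : d ∈ G := by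
  rw [← hd]
  exact AddSubgroup.mem_sup_left (AddSubgroup.mem_zmultiples d)

theorem GeneratesRegQuotient.reg_le {d : V} (hd : GeneratesRegQuotient G d) : reg G ≤ G :=
  le_sup_right.trans_eq hd

/-- A generator is `k d + a` with `a ∈ A`, and `d ∈ G₁` has no coordinates of type `τ`, so its
`τ`-part is that of `a`. A main decomposition alone does not exclude the junk value `m_τ = 0`. -/
theorem IsABasis.mInv_eq_one [Fintype (BasisIndex G G₁ C)]
    [DecidableEq (BasisIndex G G₁ C)] (he : IsABasis G G₁ C e)
    (hrigid : IsBlockRigid G) (hring : IsOfRingType G) (hmain : IsMainDecomposition G G₁ C)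
    {c : V →ₗ[ℚ] (BasisIndex G G₁ C → ℚ)}
    (F : IsFrame (reg G) (fun x : BasisIndex G G₁ C => (x.1 : GroupType)) (fun x => e x.1 x.2) c)
    {τ : GroupType} (hτ₁ : τ ∉ critTypes G₁) : mInv G τ = 1 := by
  obtain ⟨d, s, hs⟩ := he.isBBasis.nonempty
  obtain ⟨hcd, -⟩ := hs.coord_eq hmain F.dual
  have hd := hs.mem.2
  have hhull : ∀ σ, ∀ y ∈ hullComponent G σ, y = ∑ i, c y i • e i.1 i.2 ∧
      IsSupported (fun x : BasisIndex G G₁ C => (x.1 : GroupType)) c σ y := by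
    intro σ y hy
    induction hy using Submodule.span_induction with
    | mem y hy =>
      by_cases hσ : σ ∈ critTypes G
      · have h := (he.mem_regComponent_iff hrigid hring F hσ).1 hy
        exact ⟨((F.mem_iff y).1 h.1).1, h.2⟩
      · have hbot : regComponent G σ = ⊥ := not_not.1 hσ
        rw [hbot] at hy
        obtain rfl : y = 0 := hy
        exact ⟨by simp, fun j _ => by simp⟩
    | zero => exact ⟨by simp, fun j _ => by simp⟩
    | add x y _ _ hx hy =>
      refine ⟨?_, fun j hj => by simp [hx.2 j hj, hy.2 j hj]⟩
      conv_lhs => rw [hx.1, hy.1]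
      simp [add_smul, Finset.sum_add_distrib]
    | smul r x _ hx =>
      refine ⟨?_, fun j hj => by simp [hx.2 j hj]⟩
      conv_lhs => rw [hx.1]
      simp [mul_smul, Finset.smul_sum]
  have hproj : ∀ d', GeneratesRegQuotient G d' → proj G τ d' ∈ reg G := by
    intro d' hd'
    unfold proj
    -- In the default case the projection is 0, which lies in the regulator, so existence of the
    -- decomposition is not needed.
    split_ifs with h
    · obtain ⟨hy, hdy⟩ := h.choose_spec
      set y := h.choose
      obtain ⟨k, a, ha, hka⟩ := hd.exists_eq hd'.mem
      obtain ⟨hy1, hy2⟩ := hhull τ y hy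
      have hle : (⨆ (σ : GroupType) (_ : σ ≠ τ), hullComponent G σ) ≤
          ⨅ (i : BasisIndex G G₁ C) (_ : (i.1 : GroupType) = τ),
            LinearMap.ker (LinearMap.proj i ∘ₗ c) := by
        refine iSup₂_le fun σ hσ z hz => ?_
        simp only [Submodule.mem_iInf]
        exact fun i hi => (hhull σ z hz).2 i (hi.trans_ne hσ.symm)
      have hdy' := hle hdy
      simp only [Submodule.mem_iInf, LinearMap.mem_ker, LinearMap.comp_apply,
        LinearMap.proj_apply, map_sub, sub_eq_zero] at hdy'
      rw [hy1]
      refine F.sum_mem fun i => ?_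
      by_cases hi : (i.1 : GroupType) = τ
      · have h0 : c d i = 0 := by
          rw [hcd, if_neg fun h0 => hτ₁ (hi ▸ mem_critTypes_of_snd_eq_zero h0)]
        rw [← hdy' i hi, hka, map_add, map_zsmul, Pi.add_apply, Pi.smul_apply, h0, smul_zero,
          zero_add]
        exact ((F.mem_iff a).1 ha).2 i
      · rw [hy2 i hi]
        exact zero_mem _
    · exact zero_mem _
  have hone : ∀ d', GeneratesRegQuotient G d' →
      addOrderOf (QuotientAddGroup.mk (proj G τ d') : V ⧸ reg G) = 1 := by
    intro d' hd'
    rw [(QuotientAddGroup.eq_zero_iff _).2 (hproj d' hd'), addOrderOf_zero]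
  obtain ⟨d', hd', h⟩ : mInv G τ ∈ {m | ∃ d : V, GeneratesRegQuotient G d ∧
      m = addOrderOf (QuotientAddGroup.mk (proj G τ d) : V ⧸ reg G)} :=
    Nat.sInf_mem ⟨_, d, hd, rfl⟩
  rw [h, hone d' hd']

/-- The integer `k` is the multiple of `X` to be subtracted. The right-hand side is the form in
which the conditions arise from the products `d e_j`, `e_j d` and `d·d`; the Bézout computations
translate the corner entry. -/
theorem mem_groupM_iff {e₀ : GroupType → V} {d : V} {U : GroupType → ℕ → ℕ → V}
    (hsub : critTypes G₁ ⊆ critTypes G)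
    (hm₀ : ∀ τ ∈ critTypes G₁, mInv G τ ≠ 0)
    (hm₁ : ∀ τ, τ ∉ critTypes G₁ → mInv G τ = 1)
    (he₀ : ∀ τ ∈ critTypes G₁, e₀ τ ∈ regComponent G τ)
    (hU : ∀ τ ∈ critTypes G, ∀ i ∈ idx G₁ C τ, ∀ j ∈ idx G₁ C τ, U τ i j ∈ regComponent G τ)
    (hd : d ∈ genSetOf G G₁ e₀) :
    matrixTuple G G₁ C U ∈ groupM G G₁ C e₀ d ↔ ∃ k : ℤ, ∀ τ ∈ critTypes G₁,
      (∀ j ∈ idx G₁ C τ, (1 / mInv G τ : ℚ) • U τ 0 j ∈ regComponent G τ ∧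
        (1 / mInv G τ : ℚ) • U τ j 0 ∈ regComponent G τ) ∧
      ((stdCoeff G G₁ e₀ d τ : ℚ) / mInv G τ * (stdCoeff G G₁ e₀ d τ / mInv G τ)) • U τ 0 0 -
        (k : ℚ) • ((stdCoeff G G₁ e₀ d τ : ℚ) / mInv G τ) • e₀ τ ∈ regComponent G τ := by
  have hX : ∀ (k : ℤ) (τ : critTypes G) (i j : idx G₁ C τ), (k • tupleX G G₁ C e₀ d) τ i j =
      if (i : ℕ) = 0 ∧ (j : ℕ) = 0 then (k : ℚ) • ((mInv G τ : ℚ) *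
        (Int.gcdA (stdCoeff G G₁ e₀ d τ) (mInv G τ) : ℚ)) • e₀ τ else 0 := by
    intro k τ i j
    change k • tupleX G G₁ C e₀ d τ i j = _
    unfold tupleX
    split_ifs
    · rw [Int.cast_smul_eq_zsmul, ← Int.cast_smul_eq_zsmul ℚ (_ * _)]
      push_cast
      rfl
    · simp
  have key : matrixTuple G G₁ C U ∈ groupM G G₁ C e₀ d ↔
      ∃ k : ℤ, matrixTuple G G₁ C U - k • tupleX G G₁ C e₀ d ∈ M2 G G₁ C := by
    unfold groupM
    rw [AddSubgroup.mem_sup]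
    constructor
    · rintro ⟨y, hy, Y, hY, h⟩
      obtain ⟨k, rfl⟩ := AddSubgroup.mem_zmultiples_iff.1 hy
      exact ⟨k, by rwa [← h, add_sub_cancel_left]⟩
    · rintro ⟨k, hk⟩
      exact ⟨_, AddSubgroup.mem_zmultiples_iff.2 ⟨k, rfl⟩, _, hk, add_sub_cancel _ _⟩
  rw [key]
  refine exists_congr fun k => ⟨fun h τ hτ => ?_, fun h τ i j => ?_⟩
  · have hm := hm₀ τ hτ
    have hb := stdCoeff_bezout hd hτ
    have h0 : 0 ∈ idx G₁ C τ := zero_mem_idx.2 hτ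
    have h' := h ⟨τ, hsub hτ⟩
    have hbot : IsBot (⟨0, h0⟩ : idx G₁ C τ) := (isBot_iff hτ).2 rfl
    -- The corner of `kX` is itself in `m_τ A_τ`, so subtracting it does not affect the condition
    -- modulo `m_τ`.
    have hXm : (1 / mInv G τ : ℚ) • (k : ℚ) • ((mInv G τ : ℚ) *
        (Int.gcdA (stdCoeff G G₁ e₀ d τ) (mInv G τ) : ℚ)) • e₀ τ ∈ regComponent G τ := by
      have hm' : (mInv G τ : ℚ) ≠ 0 := by exact_mod_cast hm
      rw [show (1 / mInv G τ : ℚ) • (k : ℚ) • ((mInv G τ : ℚ) *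
        (Int.gcdA (stdCoeff G G₁ e₀ d τ) (mInv G τ) : ℚ)) • e₀ τ =
        ((k * Int.gcdA (stdCoeff G G₁ e₀ d τ) (mInv G τ) : ℤ) : ℚ) • e₀ τ by
          rw [smul_smul, smul_smul]
          congr 1
          push_cast
          field_simp]
      exact intCast_smul_mem _ (he₀ τ hτ)
    have hrow : ∀ i j : idx G₁ C τ, IsBot i ∨ IsBot j →
        (1 / mInv G τ : ℚ) • U τ i j ∈ regComponent G τ := by
      intro i j hij
      have h1 := (mem_mulSubgroup_iff hm).1 ((h' i j).2.1 hij)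
      rw [Pi.sub_apply, Matrix.sub_apply, hX, smul_sub] at h1
      split_ifs at h1
      · have := add_mem h1 hXm
        rwa [sub_add_cancel] at this
      · rwa [smul_zero, sub_zero] at h1
    refine ⟨fun j hj => ⟨hrow ⟨0, h0⟩ ⟨j, hj⟩ (Or.inl hbot), hrow ⟨j, hj⟩ ⟨0, h0⟩ (Or.inr hbot)⟩, ?_⟩
    have h2 := (mem_mulSubgroup_iff (pow_ne_zero 2 hm)).1
      ((h' ⟨0, h0⟩ ⟨0, h0⟩).2.2 ⟨hbot, hbot⟩)
    rw [Pi.sub_apply, Matrix.sub_apply, hX, if_pos ⟨rfl, rfl⟩] at h2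
    push_cast at h2
    exact mul_smul_sub_smul_mem hm hb (he₀ τ hτ) h2
  · rw [Pi.sub_apply, Matrix.sub_apply, hX]
    have hUij : matrixTuple G G₁ C U τ i j ∈ regComponent G τ := hU τ τ.2 i i.2 j j.2
    by_cases hτ : (τ : GroupType) ∈ critTypes G₁
    · have hm := hm₀ τ hτ
      have hb := stdCoeff_bezout hd hτ
      have h' := h τ hτ
      rw [isBot_iff hτ, isBot_iff hτ]
      have h1 : (i : ℕ) = 0 ∨ (j : ℕ) = 0 →
          matrixTuple G G₁ C U τ i j ∈ mulSubgroup (mInv G τ) (regComponent G τ) := by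
        rw [mem_mulSubgroup_iff hm]
        unfold matrixTuple
        rintro (h0 | h0)
        · rw [h0]
          exact (h'.1 j j.2).1
        · rw [h0]
          exact (h'.1 i i.2).2
      split_ifs with h0
      · have h2 := one_div_sq_smul_mem hm hb (he₀ τ hτ) (h'.1 0 (zero_mem_idx.2 hτ)).1 h'.2
        have hU0 : matrixTuple G G₁ C U τ i j = U τ 0 0 := by
          unfold matrixTuple
          rw [h0.1, h0.2]
        rw [hU0]
        have h3 := (mem_mulSubgroup_iff (K := regComponent G τ) (pow_ne_zero 2 hm)).2
          (by push_cast; exact h2)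
        have h4 : mulSubgroup (mInv G τ ^ 2) (regComponent G τ) ≤
            mulSubgroup (mInv G τ) (regComponent G τ) := by
          rintro _ ⟨y, hy, rfl⟩
          refine ⟨mInv G τ • y, nsmul_mem hy _, ?_⟩
          simp only [nsmulAddMonoidHom_apply, smul_smul, sq]
        have h5 : mulSubgroup (mInv G τ) (regComponent G τ) ≤ regComponent G τ := by
          rintro _ ⟨y, hy, rfl⟩
          exact nsmul_mem hy _
        exact ⟨h5 (h4 h3), fun _ => h4 h3, fun _ => h3⟩
      · rw [sub_zero]
        exact ⟨hUij, h1, fun hh => absurd hh h0⟩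
    · have hi : ¬ ((i : ℕ) = 0 ∧ (j : ℕ) = 0) := by
        rintro ⟨h0, -⟩
        exact hτ (zero_mem_idx.1 (h0 ▸ i.2 : 0 ∈ idx G₁ C (τ : GroupType)))
      -- Here the first row has index 1 rather than 0, but `m_τ = 1` makes its conditions void.
      rw [if_neg hi, sub_zero, hm₁ τ hτ]
      have h1 : ∀ n : ℕ, matrixTuple G G₁ C U τ i j ∈ mulSubgroup (1 ^ n) (regComponent G τ) :=
        fun n => ⟨_, hUij, by simp⟩
      exact ⟨hUij, fun _ => by simpa using h1 1, fun _ => h1 2⟩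

end Invariants

/-! ### Projections onto homogeneous components -/

section Projection

variable {V : Type*} [AddCommGroup V] [Module ℚ V] {ι : Type*} [Fintype ι] [DecidableEq ι]
  {A : AddSubgroup V} {t : ι → GroupType} {v : ι → V} {c : V →ₗ[ℚ] (ι → ℚ)}

open scoped Classical in
/-- The projection of the divisible hull onto its component of type `τ`. -/
noncomputable def typeProj (t : ι → GroupType) (v : ι → V) (c : V →ₗ[ℚ] (ι → ℚ)) (τ : GroupType) :
    V →ₗ[ℚ] V :=
  ∑ i, if t i = τ then (LinearMap.proj i ∘ₗ c).smulRight (v i) else 0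

open scoped Classical in
theorem typeProj_apply (τ : GroupType) (x : V) :
    typeProj t v c τ x = ∑ i, (if t i = τ then c x i else 0) • v i := by
  unfold typeProj
  rw [LinearMap.sum_apply]
  refine Finset.sum_congr rfl fun i _ => ?_
  split_ifs <;> simp

theorem IsFrame.typeProj_eq_self (F : IsFrame A t v c) {τ : GroupType} {x : V} (hx : x ∈ A)
    (hs : IsSupported t c τ x) : typeProj t v c τ x = x := by
  classical
  rw [typeProj_apply]
  conv_rhs => rw [((F.mem_iff x).1 hx).1]
  refine Finset.sum_congr rfl fun i _ => ?_
  split_ifs with h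
  · rfl
  · rw [hs i h]

theorem typeProj_eq_zero {τ σ : GroupType} (hne : σ ≠ τ) {x : V} (hs : IsSupported t c σ x) :
    typeProj t v c τ x = 0 := by
  classical
  rw [typeProj_apply]
  refine Finset.sum_eq_zero fun i _ => ?_
  split_ifs with h
  · rw [hs i (h.trans_ne hne.symm), zero_smul]
  · rw [zero_smul]

theorem IsFrame.typeProj_mem (F : IsFrame A t v c) {τ : GroupType} {x : V} (hx : x ∈ A) :
    typeProj t v c τ x ∈ A ∧ IsSupported t c τ (typeProj t v c τ x) := by
  classical
  rw [typeProj_apply]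
  refine ⟨F.sum_mem fun i => ?_, fun j hj => ?_⟩
  · split_ifs
    · exact ((F.mem_iff x).1 hx).2 i
    · exact zero_mem _
  · rw [dual_sum F.dual, if_neg hj]

theorem IsFrame.isSupported_basis (F : IsFrame A t v c) (i : ι) : IsSupported t c (t i) (v i) := by
  intro j hj
  rw [F.dual, Pi.single_eq_of_ne]
  rintro rfl
  exact hj rfl

end Projection

/-! ### Multiplications -/

section Multiplication

variable {V : Type*} [AddCommGroup V] [Module ℚ V] {G G₁ C : AddSubgroup V}
  {e : GroupType → ℕ → V} {U : GroupType → ℕ → ℕ → V}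

theorem snd_mem_idx {x y : BasisIndex G G₁ C} (h : (x.1 : GroupType) = y.1) :
    (y.2 : ℕ) ∈ idx G₁ C (x.1 : GroupType) := by
  rw [h]
  exact y.2.2

/-- The product is as divisible as each factor, hence supported on both types at once. -/
theorem mul_eq_zero_of_ne [Fintype (BasisIndex G G₁ C)] [DecidableEq (BasisIndex G G₁ C)]
    {c : V →ₗ[ℚ] (BasisIndex G G₁ C → ℚ)}
    (F : IsFrame (reg G) (fun x : BasisIndex G G₁ C => (x.1 : GroupType)) (fun x => e x.1 x.2) c)
    (hAG : reg G ≤ G) {N : ℕ} (hN : N ≠ 0) (hNG : ∀ x ∈ G, N • x ∈ reg G)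
    (μ : (G ⊗[ℤ] G) →+ G) {x y : BasisIndex G G₁ C} (hxy : (x.1 : GroupType) ≠ y.1) {X Y : G}
    (hX : (X : V) = e x.1 x.2) (hY : (Y : V) = e y.1 y.2) : ((μ (X ⊗ₜ[ℤ] Y) : G) : V) = 0 := by
  have h1 : IsSupported (fun x : BasisIndex G G₁ C => (x.1 : GroupType)) c x.1
      (μ (X ⊗ₜ[ℤ] Y) : V) := by
    refine F.isSupported hN hNG (F.incomparable x) fun p hp k => ?_
    obtain ⟨w, hw, h⟩ := F.isPDivisible hp k
    refine ⟨_, (μ ((⟨w, hAG hw⟩ : G) ⊗ₜ[ℤ] Y)).2, ?_⟩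
    have : X = (p : ℕ) ^ k • (⟨w, hAG hw⟩ : G) := Subtype.ext (hX.trans h.symm)
    rw [this]
    exact (map_nsmul (AddMonoidHom.mk' (fun X : G => ((μ (X ⊗ₜ[ℤ] Y) : G) : V))
      (fun a b => by simp [TensorProduct.add_tmul])) _ _).symm
  have h2 : IsSupported (fun x : BasisIndex G G₁ C => (x.1 : GroupType)) c y.1
      (μ (X ⊗ₜ[ℤ] Y) : V) := by
    refine F.isSupported hN hNG (F.incomparable y) fun p hp k => ?_
    obtain ⟨w, hw, h⟩ := F.isPDivisible hp k
    refine ⟨_, (μ (X ⊗ₜ[ℤ] (⟨w, hAG hw⟩ : G))).2, ?_⟩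
    have : Y = (p : ℕ) ^ k • (⟨w, hAG hw⟩ : G) := Subtype.ext (hY.trans h.symm)
    rw [this]
    exact (map_nsmul (AddMonoidHom.mk' (fun Y : G => ((μ (X ⊗ₜ[ℤ] Y) : G) : V))
      (fun a b => by simp [TensorProduct.tmul_add])) _ _).symm
  rw [F.eq_sum hN (hNG _ (μ (X ⊗ₜ[ℤ] Y)).2)]
  refine Finset.sum_eq_zero fun i _ => ?_
  by_cases hi : (i.1 : GroupType) = x.1
  · rw [h2 i (hi.trans_ne hxy), zero_smul]
  · rw [h1 i hi, zero_smul]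

theorem DefinesMultiplication.mem_groupM (hCRQ : IsCRQ G) (hrigid : IsBlockRigid G)
    (hring : IsOfRingType G) (hmain : IsMainDecomposition G G₁ C) (he : IsABasis G G₁ C e)
    [Fintype (BasisIndex G G₁ C)] [DecidableEq (BasisIndex G G₁ C)]
    {c : V →ₗ[ℚ] (BasisIndex G G₁ C → ℚ)}
    (F : IsFrame (reg G) (fun x : BasisIndex G G₁ C => (x.1 : GroupType)) (fun x => e x.1 x.2) c)
    (hU : ∀ τ ∈ critTypes G, ∀ i ∈ idx G₁ C τ, ∀ j ∈ idx G₁ C τ, U τ i j ∈ regComponent G τ)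
    (h : DefinesMultiplication G G₁ C e U) {d : V} (hd : d ∈ genSetOf G G₁ (fun τ => e τ 0)) :
    ∃ k : ℤ, ∀ τ ∈ critTypes G₁,
      (∀ j ∈ idx G₁ C τ, (1 / mInv G τ : ℚ) • U τ 0 j ∈ regComponent G τ ∧
        (1 / mInv G τ : ℚ) • U τ j 0 ∈ regComponent G τ) ∧
      ((stdCoeff G G₁ (fun τ => e τ 0) d τ : ℚ) / mInv G τ *
        (stdCoeff G G₁ (fun τ => e τ 0) d τ / mInv G τ)) • U τ 0 0 -
        (k : ℚ) • ((stdCoeff G G₁ (fun τ => e τ 0) d τ : ℚ) / mInv G τ) • e τ 0 ∈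
          regComponent G τ := by
  have hs := stdCoeff_isStandardRep hd
  obtain ⟨hcd, hds⟩ := hs.coord_eq hmain F.dual
  set s := stdCoeff G G₁ (fun τ => e τ 0) d with hsdef
  have hgen := hs.mem.2
  have hAG := hgen.reg_le
  obtain ⟨N, hN, hNG⟩ := F.exists_nsmul_mem hgen hds
  obtain ⟨μ, hμ⟩ := h
  let v : BasisIndex G G₁ C → G := fun x => ⟨e x.1 x.2, hAG (F.mem x)⟩
  let D : G := ⟨d, hgen.mem⟩
  have hsame : ∀ x y : BasisIndex G G₁ C, (x.1 : GroupType) = y.1 →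
      ((μ (v x ⊗ₜ[ℤ] v y) : G) : V) = U x.1 x.2 y.2 := by
    intro x y hxy
    exact hμ x.1 x.1.2 x.2 x.2.2 y.2 (snd_mem_idx hxy) (v x) (v y) rfl (by rw [hxy])
  have hcross : ∀ x y : BasisIndex G G₁ C, (x.1 : GroupType) ≠ y.1 →
      ((μ (v x ⊗ₜ[ℤ] v y) : G) : V) = 0 := fun x y hxy =>
    mul_eq_zero_of_ne F hAG hN hNG μ hxy rfl rfl
  have hleft : ∀ Y : G, ((μ (D ⊗ₜ[ℤ] Y) : G) : V) =
      ∑ x, c d x • ((μ (v x ⊗ₜ[ℤ] Y) : G) : V) := fun Y =>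
    map_eq_sum_smul (AddMonoidHom.mk' (fun X : G => ((μ (X ⊗ₜ[ℤ] Y) : G) : V))
      (fun a b => by simp [TensorProduct.add_tmul])) v hds
  have hright : ∀ X : G, ((μ (X ⊗ₜ[ℤ] D) : G) : V) =
      ∑ y, c d y • ((μ (X ⊗ₜ[ℤ] v y) : G) : V) := fun X =>
    map_eq_sum_smul (AddMonoidHom.mk' (fun Y : G => ((μ (X ⊗ₜ[ℤ] Y) : G) : V))
      (fun a b => by simp [TensorProduct.tmul_add])) v hds
  -- Within each type, `d` has at most one nonzero coordinate, at index 0; so every sum below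
  -- collapses to one term per type.
  have huniq : ∀ x y : BasisIndex G G₁ C, (x.1 : GroupType) = y.1 → c d x ≠ 0 → (y.2 : ℕ) = 0 →
      x = y := by
    intro x y hxy hx hy
    refine basisIndex_ext hxy ?_
    rw [hcd] at hx
    rw [hy]
    by_contra h0
    exact hx (if_neg h0)
  have hleft' : ∀ x y : BasisIndex G G₁ C, (x.1 : GroupType) = y.1 → (x.2 : ℕ) = 0 →
      ((μ (D ⊗ₜ[ℤ] v y) : G) : V) = c d x • U x.1 x.2 y.2 := by
    intro x y hxy hx
    rw [hleft, Finset.sum_eq_single x, hsame x y hxy]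
    · intro z _ hz
      by_cases hzy : (z.1 : GroupType) = y.1
      · rw [show c d z = 0 from by_contra fun h0 => hz (huniq z x (hzy.trans hxy.symm) h0 hx), zero_smul]
      · rw [hcross z y hzy, smul_zero]
    · exact fun h => absurd (Finset.mem_univ x) h
  have hright' : ∀ x y : BasisIndex G G₁ C, (x.1 : GroupType) = y.1 → (y.2 : ℕ) = 0 →
      ((μ (v x ⊗ₜ[ℤ] D) : G) : V) = c d y • U x.1 x.2 y.2 := by
    intro x y hxy hy
    rw [hright, Finset.sum_eq_single y, hsame x y hxy]
    · intro z _ hz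
      by_cases hzx : (x.1 : GroupType) = z.1
      · rw [show c d z = 0 from by_contra fun h0 => hz (huniq z y (hzx.symm.trans hxy) h0 hy), zero_smul]
      · rw [hcross x z hzx, smul_zero]
    · exact fun h => absurd (Finset.mem_univ y) h
  have hnz : ∀ x, c d x ≠ 0 → (x.2 : ℕ) = 0 := by
    intro x hx
    rw [hcd] at hx
    by_contra h0
    exact hx (if_neg h0)
  have hdd : ((μ (D ⊗ₜ[ℤ] D) : G) : V) = ∑ x, (c d x * c d x) • U x.1 x.2 x.2 := by
    rw [hleft]
    refine Finset.sum_congr rfl fun x _ => ?_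
    by_cases hx : c d x = 0
    · rw [hx, mul_zero, zero_smul, zero_smul]
    · rw [hright' x x rfl (hnz x hx), smul_smul]
  have hpure : ∀ τ, ∀ z ∈ G,
      IsSupported (fun x : BasisIndex G G₁ C => (x.1 : GroupType)) c τ z → z ∈ reg G :=
    fun τ z hz hzs => F.mem_reg_of_isSupported hCRQ.1 hgen hds
      (fun i j hij hi hj => huniq i j hij hi (hnz j hj)) hz hzs
  -- The integer is read off from `d·d ∈ ℤd + A` before a type is fixed, so it serves all types.
  obtain ⟨k, a, ha, hka⟩ := hgen.exists_eq (μ (D ⊗ₜ[ℤ] D)).2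
  refine ⟨k, fun τ hτ => ?_⟩
  have hτG := ((hmain.mem_critTypes_iff τ).1 hτ)
  have hm : mInv G τ ≠ 0 := by omega
  have hb := stdCoeff_bezout hd hτ
  have h0 : 0 ∈ idx G₁ C τ := zero_mem_idx.2 hτ
  have hK := fun {x : V} => he.mem_regComponent_iff hrigid hring F hτG.1 (x := x)
  let o : BasisIndex G G₁ C := ⟨⟨τ, hτG.1⟩, ⟨0, h0⟩⟩
  have hco : c d o = (s τ : ℚ) / mInv G τ := by
    rw [hcd]
    exact if_pos rfl
  have hsupp : ∀ (q : ℚ) (i j : ℕ), i ∈ idx G₁ C τ → j ∈ idx G₁ C τ →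
      IsSupported (fun x : BasisIndex G G₁ C => (x.1 : GroupType)) c τ (q • U τ i j) := by
    intro q i j hi hj l hl
    rw [map_smul, Pi.smul_apply, (hK.1 (hU τ hτG.1 i hi j hj)).2 l hl, smul_zero]
  refine ⟨fun j hj => ⟨?_, ?_⟩, ?_⟩
  · refine one_div_smul_mem hm hb (hU τ hτG.1 0 h0 j hj) ?_
    have h1 := hleft' o ⟨⟨τ, hτG.1⟩, ⟨j, hj⟩⟩ rfl rfl
    rw [hco] at h1
    refine hK.2 ⟨hpure τ _ ?_ (hsupp _ 0 j h0 hj), hsupp _ 0 j h0 hj⟩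
    exact h1 ▸ (μ _).2
  · refine one_div_smul_mem hm hb (hU τ hτG.1 j hj 0 h0) ?_
    have h1 := hright' ⟨⟨τ, hτG.1⟩, ⟨j, hj⟩⟩ o rfl rfl
    rw [hco] at h1
    refine hK.2 ⟨hpure τ _ ?_ (hsupp _ j 0 hj h0), hsupp _ j 0 hj h0⟩
    exact h1 ▸ (μ _).2
  -- Projecting `d·d = kd + a` to type `τ` isolates the corner condition.
  · let P := typeProj (fun x : BasisIndex G G₁ C => (x.1 : GroupType)) (fun x => e x.1 x.2) c τ
    have hPd : P d = c d o • e τ 0 := by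
      conv_lhs => rw [hds]
      rw [map_sum, Finset.sum_eq_single o, map_smul]
      · congr 1
        exact F.typeProj_eq_self (F.mem o) (F.isSupported_basis o)
      · intro x _ hx
        rw [map_smul]
        by_cases hxτ : (x.1 : GroupType) = τ
        · rw [show c d x = 0 from by_contra fun h0 => hx (huniq x o hxτ h0 rfl), zero_smul]
        · rw [show P (e x.1 x.2) = 0 from typeProj_eq_zero hxτ (F.isSupported_basis x), smul_zero]
      · exact fun h => absurd (Finset.mem_univ o) h
    have hPdd : P (∑ x, (c d x * c d x) • U x.1 x.2 x.2) = (c d o * c d o) • U τ 0 0 := by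
      rw [map_sum, Finset.sum_eq_single o, map_smul]
      · congr 1
        have := hK.1 (hU τ hτG.1 0 h0 0 h0)
        exact F.typeProj_eq_self this.1 this.2
      · intro x _ hx
        rw [map_smul]
        by_cases hxτ : (x.1 : GroupType) = τ
        · rw [show c d x = 0 from by_contra fun h0 => hx (huniq x o hxτ h0 rfl), zero_mul, zero_smul]
        · have := (he.mem_regComponent_iff hrigid hring F x.1.2).1
            (hU x.1 x.1.2 x.2 x.2.2 x.2 x.2.2)
          rw [show P (U x.1 x.2 x.2) = 0 from typeProj_eq_zero hxτ this.2, smul_zero]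
      · exact fun h => absurd (Finset.mem_univ o) h
    have h1 := congrArg P (hdd.symm.trans hka)
    rw [hPdd, map_add, map_zsmul, hPd, hco, ← Int.cast_smul_eq_zsmul ℚ] at h1
    rw [h1, add_sub_cancel_left]
    exact hK.2 (F.typeProj_mem ha)

/-- The bilinear form with the prescribed values exists on all of `V` through the coordinates; the
hypotheses are what is needed for it to preserve `G = ℤd + A`. -/
theorem definesMultiplication_of_exists (hrigid : IsBlockRigid G)
    (hring : IsOfRingType G) (hmain : IsMainDecomposition G G₁ C) (he : IsABasis G G₁ C e)
    [Fintype (BasisIndex G G₁ C)] [DecidableEq (BasisIndex G G₁ C)]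
    {c : V →ₗ[ℚ] (BasisIndex G G₁ C → ℚ)}
    (F : IsFrame (reg G) (fun x : BasisIndex G G₁ C => (x.1 : GroupType)) (fun x => e x.1 x.2) c)
    (hU : ∀ τ ∈ critTypes G, ∀ i ∈ idx G₁ C τ, ∀ j ∈ idx G₁ C τ, U τ i j ∈ regComponent G τ)
    {d : V} {s : GroupType → ℤ} (hs : IsStandardRep G G₁ (fun τ => e τ 0) d s) {k : ℤ}
    (hk : ∀ τ ∈ critTypes G₁,
      (∀ j ∈ idx G₁ C τ, (1 / mInv G τ : ℚ) • U τ 0 j ∈ regComponent G τ ∧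
        (1 / mInv G τ : ℚ) • U τ j 0 ∈ regComponent G τ) ∧
      ((s τ : ℚ) / mInv G τ * (s τ / mInv G τ)) • U τ 0 0 -
        (k : ℚ) • ((s τ : ℚ) / mInv G τ) • e τ 0 ∈ regComponent G τ) :
    DefinesMultiplication G G₁ C e U := by
  classical
  obtain ⟨hcd, hds⟩ := hs.coord_eq hmain F.dual
  have hgen := hs.mem.2
  have hAG := hgen.reg_le
  have hnz : ∀ x, c d x ≠ 0 → (x.2 : ℕ) = 0 := by
    intro x hx
    rw [hcd] at hx
    by_contra h0
    exact hx (if_neg h0)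
  let u : BasisIndex G G₁ C → BasisIndex G G₁ C → V := fun x y =>
    if (x.1 : GroupType) = y.1 then U x.1 x.2 y.2 else 0
  have hu_ne : ∀ x y : BasisIndex G G₁ C, (x.1 : GroupType) ≠ y.1 → u x y = 0 :=
    fun x y h => if_neg h
  have hu_eq : ∀ x y : BasisIndex G G₁ C, (x.1 : GroupType) = y.1 → u x y = U x.1 x.2 y.2 :=
    fun x y h => if_pos h
  have hu : ∀ x y, u x y ∈ regComponent G x.1 := by
    intro x y
    by_cases h : (x.1 : GroupType) = y.1
    · rw [hu_eq x y h]
      exact hU x.1 x.1.2 x.2 x.2.2 y.2 (snd_mem_idx h)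
    · rw [hu_ne x y h]
      exact zero_mem _
  have hKA : ∀ (τ : critTypes G) (x : V), x ∈ regComponent G τ → x ∈ reg G := fun τ x hx =>
    ((he.mem_regComponent_iff hrigid hring F τ.2).1 hx).1
  have hdu : ∀ x y, c d x • u x y ∈ regComponent G x.1 := by
    intro x y
    by_cases hx : c d x = 0
    · rw [hx, zero_smul]
      exact zero_mem _
    by_cases h : (x.1 : GroupType) = y.1
    · have h0 := hnz x hx
      have := intCast_smul_mem (s x.1)
        ((hk x.1 (mem_critTypes_of_snd_eq_zero h0)).1 y.2 (snd_mem_idx h)).1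
      rw [hu_eq x y h, hcd, if_pos h0, h0]
      rwa [smul_smul, mul_one_div] at this
    · rw [hu_ne x y h, smul_zero]
      exact zero_mem _
  have hud : ∀ x y, c d y • u x y ∈ regComponent G x.1 := by
    intro x y
    by_cases hy : c d y = 0
    · rw [hy, zero_smul]
      exact zero_mem _
    by_cases h : (x.1 : GroupType) = y.1
    · have h0 := hnz y hy
      have hτ : (x.1 : GroupType) ∈ critTypes G₁ := by
        rw [h]
        exact mem_critTypes_of_snd_eq_zero h0
      have := intCast_smul_mem (s x.1) ((hk x.1 hτ).1 x.2 x.2.2).2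
      rw [hu_eq x y h, hcd, if_pos h0, h0, ← h]
      rwa [smul_smul, mul_one_div] at this
    · rw [hu_ne x y h, smul_zero]
      exact zero_mem _
  have hR : ∀ (x : BasisIndex G G₁ C) {r : ℚ} (z : V), r ∈ ratRing x.1 → z ∈ regComponent G x.1 →
      r • z ∈ regComponent G x.1 := fun x r z hr hz => component_smul_mem hr hz
  have hdd : ∀ x, (c d x * c d x) • u x x - (k : ℚ) • c d x • e x.1 x.2 ∈ reg G := by
    intro x
    by_cases hx : c d x = 0
    · simp [hx, zero_mem]
    · have h0 := hnz x hx
      have := (hk x.1 (mem_critTypes_of_snd_eq_zero h0)).2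
      rw [hu_eq x x rfl, hcd, if_pos h0, h0]
      exact hKA x.1 _ this
  let β : V → V → V := fun X Y => ∑ x, ∑ y, (c X x * c Y y) • u x y
  have hβ_add_left : ∀ X X' Y, β (X + X') Y = β X Y + β X' Y := by
    intro X X' Y
    simp only [β, map_add, Pi.add_apply, add_mul, add_smul, Finset.sum_add_distrib]
  have hβ_add_right : ∀ X Y Y', β X (Y + Y') = β X Y + β X Y' := by
    intro X Y Y'
    simp only [β, map_add, Pi.add_apply, mul_add, add_smul, Finset.sum_add_distrib]
  have hβ_smul_left : ∀ (n : ℤ) X Y, β (n • X) Y = n • β X Y := fun n X Y =>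
    map_zsmul (AddMonoidHom.mk' (fun X => β X Y) (fun X X' => hβ_add_left X X' Y)) n X
  have hβ_smul_right : ∀ (n : ℤ) X Y, β X (n • Y) = n • β X Y := fun n X Y =>
    map_zsmul (AddMonoidHom.mk' (fun Y => β X Y) (fun Y Y' => hβ_add_right X Y Y')) n Y
  have hAA : ∀ a ∈ reg G, ∀ b ∈ reg G, β a b ∈ reg G := by
    intro a ha b hb
    refine _root_.sum_mem fun x _ => _root_.sum_mem fun y _ => hKA x.1 _ ?_
    by_cases h : (x.1 : GroupType) = y.1
    · exact hR x _ (mul_mem (((F.mem_iff a).1 ha).2 x) (h.symm ▸ ((F.mem_iff b).1 hb).2 y)) (hu x y)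
    · rw [hu_ne x y h, smul_zero]
      exact zero_mem _
  have hDA : ∀ b ∈ reg G, β d b ∈ reg G := by
    intro b hb
    refine _root_.sum_mem fun x _ => _root_.sum_mem fun y _ => hKA x.1 _ ?_
    by_cases h : (x.1 : GroupType) = y.1
    · rw [mul_comm, mul_smul]
      exact hR x _ (h.symm ▸ ((F.mem_iff b).1 hb).2 y) (hdu x y)
    · rw [hu_ne x y h, smul_zero]
      exact zero_mem _
  have hAD : ∀ a ∈ reg G, β a d ∈ reg G := by
    intro a ha
    refine _root_.sum_mem fun x _ => _root_.sum_mem fun y _ => hKA x.1 _ ?_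
    rw [mul_smul]
    exact hR x _ (((F.mem_iff a).1 ha).2 x) (hud x y)
  -- Only diagonal terms survive, and subtracting `kd` leaves an element of `A`, because the same
  -- `k` works for every type.
  have hDD : β d d ∈ G := by
    have h1 : β d d = ∑ x, (c d x * c d x) • u x x := by
      refine Finset.sum_congr rfl fun x _ => Finset.sum_eq_single x (fun y _ hy => ?_)
        fun h => absurd (Finset.mem_univ x) h
      by_cases hxy : (x.1 : GroupType) = y.1
      · by_cases hx : c d x = 0
        · rw [hx, zero_mul, zero_smul]
        by_cases hy' : c d y = 0
        · rw [hy', mul_zero, zero_smul]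
        exact absurd (basisIndex_ext hxy.symm ((hnz y hy').trans (hnz x hx).symm)) hy
      · rw [hu_ne x y hxy, smul_zero]
    have h2 : β d d - k • d ∈ reg G := by
      have h3 : k • d = ∑ x, (k : ℚ) • c d x • e x.1 x.2 := by
        rw [← Finset.smul_sum, ← hds, Int.cast_smul_eq_zsmul]
      rw [h1, h3, ← Finset.sum_sub_distrib]
      exact _root_.sum_mem fun x _ => hdd x
    have h4 := add_mem (hAG h2) (zsmul_mem hgen.mem k)
    rwa [sub_add_cancel] at h4
  have hβG : ∀ X ∈ G, ∀ Y ∈ G, β X Y ∈ G := by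
    intro X hX Y hY
    obtain ⟨l, a, ha, rfl⟩ := hgen.exists_eq hX
    obtain ⟨n, b, hb, rfl⟩ := hgen.exists_eq hY
    rw [hβ_add_left, hβ_add_right, hβ_add_right, hβ_smul_left, hβ_smul_left, hβ_smul_right,
      hβ_smul_right]
    exact add_mem (add_mem (zsmul_mem (zsmul_mem hDD n) l) (zsmul_mem (hAG (hDA b hb)) l))
      (add_mem (zsmul_mem (hAG (hAD a ha)) n) (hAG (hAA a ha b hb)))
  let f : G →ₗ[ℤ] G →ₗ[ℤ] G := LinearMap.mk₂ ℤ (fun X Y => ⟨β X Y, hβG X X.2 Y Y.2⟩)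
    (fun X X' Y => Subtype.ext (hβ_add_left X X' Y)) (fun n X Y => Subtype.ext (hβ_smul_left n X Y))
    (fun X Y Y' => Subtype.ext (hβ_add_right X Y Y')) (fun n X Y => Subtype.ext (hβ_smul_right n X Y))
  refine ⟨(TensorProduct.lift f).toAddMonoidHom, fun τ hτ i hi j hj X Y hX hY => ?_⟩
  have h1 : (((TensorProduct.lift f).toAddMonoidHom (X ⊗ₜ[ℤ] Y) : G) : V) = β X Y := by
    rw [LinearMap.toAddMonoidHom_coe, TensorProduct.lift.tmul]
    rfl
  have h2 := F.dual ⟨⟨τ, hτ⟩, ⟨i, hi⟩⟩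
  have h3 := F.dual ⟨⟨τ, hτ⟩, ⟨j, hj⟩⟩
  have h4 := hu_eq ⟨⟨τ, hτ⟩, ⟨i, hi⟩⟩ ⟨⟨τ, hτ⟩, ⟨j, hj⟩⟩ rfl
  simp only at h2 h3 h4
  rw [h1, hX, hY]
  simp only [β]
  rw [h2, h3, ← h4, Finset.sum_eq_single ⟨⟨τ, hτ⟩, ⟨i, hi⟩⟩,
    Finset.sum_eq_single ⟨⟨τ, hτ⟩, ⟨j, hj⟩⟩]
  · rw [Pi.single_eq_same, Pi.single_eq_same, mul_one, one_smul]
  · intro y _ hy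
    rw [Pi.single_eq_of_ne hy, mul_zero, zero_smul]
  · exact fun h => absurd (Finset.mem_univ _) h
  · intro x _ hx
    refine Finset.sum_eq_zero fun y _ => ?_
    rw [Pi.single_eq_of_ne hx, zero_mul, zero_smul]
  · exact fun h => absurd (Finset.mem_univ _) h

end Multiplication

end CRQ

/-! ### The equivalence of the three conditions -/

theorem theorem2p4 {V : Type*} [AddCommGroup V] [Module ℚ V]
    (G G₁ C : AddSubgroup V)
    (hCRQ : CRQ.IsCRQ G) (hrigid : CRQ.IsBlockRigid G) (hring : CRQ.IsOfRingType G)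
    (hmain : CRQ.IsMainDecomposition G G₁ C)
    (e : CRQ.GroupType → ℕ → V) (he : CRQ.IsABasis G G₁ C e)
    (U : CRQ.GroupType → ℕ → ℕ → V)
    (hU : ∀ τ ∈ CRQ.critTypes G, ∀ i ∈ CRQ.idx G₁ C τ, ∀ j ∈ CRQ.idx G₁ C τ,
      U τ i j ∈ CRQ.regComponent G τ) :
    List.TFAE [
      CRQ.DefinesMultiplication G G₁ C e U,
      ∀ d ∈ CRQ.genSetOf G G₁ (fun τ => e τ 0),
        CRQ.matrixTuple G G₁ C U ∈ CRQ.groupM G G₁ C (fun τ => e τ 0) d,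
      ∃ d ∈ CRQ.genSetOf G G₁ (fun τ => e τ 0),
        CRQ.matrixTuple G G₁ C U ∈ CRQ.groupM G G₁ C (fun τ => e τ 0) d] := by
  classical
  obtain ⟨d₀, hd₀⟩ := he.isBBasis.nonempty
  have hAG := (CRQ.stdCoeff_isStandardRep hd₀).mem.2.reg_le
  have hmem : ∀ x : CRQ.BasisIndex G G₁ C, e x.1 x.2 ∈ G := fun x => by
    refine hAG ?_
    rw [← he.closure_eq]
    exact AddSubgroup.subset_closure ⟨x.1, x.1.2, x.2, x.2.2, 1, one_mem _, (one_smul _ _).symm⟩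
  have := CRQ.finite_of_isACD hCRQ.1 he.linearIndependent hmem
  have := Fintype.ofFinite (CRQ.BasisIndex G G₁ C)
  obtain ⟨c, F⟩ := he.exists_isFrame hrigid hring
  have hsub : CRQ.critTypes G₁ ⊆ CRQ.critTypes G := fun τ hτ =>
    ((hmain.mem_critTypes_iff τ).1 hτ).1
  have hm₀ : ∀ τ ∈ CRQ.critTypes G₁, CRQ.mInv G τ ≠ 0 := fun τ hτ => by
    have := ((hmain.mem_critTypes_iff τ).1 hτ).2
    omega
  have hm₁ : ∀ τ, τ ∉ CRQ.critTypes G₁ → CRQ.mInv G τ = 1 := fun τ hτ =>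
    he.mInv_eq_one hrigid hring hmain F hτ
  have he₀ : ∀ τ ∈ CRQ.critTypes G₁, e τ 0 ∈ CRQ.regComponent G τ := fun τ hτ =>
    he.mem τ (hsub hτ) 0 (CRQ.zero_mem_idx.2 hτ)
  tfae_have 1 → 2 := fun h d hd =>
    (CRQ.mem_groupM_iff hsub hm₀ hm₁ he₀ hU hd).2 (h.mem_groupM hCRQ hrigid hring hmain he F hU hd)
  tfae_have 2 → 3 := fun h => ⟨d₀, hd₀, h d₀ hd₀⟩
  tfae_have 3 → 1 := by
    rintro ⟨d, hd, h⟩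
    obtain ⟨k, hk⟩ := (CRQ.mem_groupM_iff hsub hm₀ hm₁ he₀ hU hd).1 h
    exact CRQ.definesMultiplication_of_exists hrigid hring hmain he F hU
      (CRQ.stdCoeff_isStandardRep hd) hk
  tfae_finish
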